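/- Let $\mathcal T=(\mathcal V,\mathcal E,\ell)$ be a finite tree with edge lengths $T^e=\ell(e)>0$, identified with the space obtained by gluing the segments $[0,T^e]$ at the vertices; let $\mathcal C_{\mathcal T}=C(\mathcal T,\mathbb R^d)$ (topology of uniform convergence, Borel $\sigma$-algebra) be the space of continuous paths on it, and let $X$ be the canonical process. Let $\mathcal S\subset\mathcal V$, and let $\mu_i$, $i\in\mathcal S$, be probability measures on $\mathbb R^d$. Let $\mathbb Q$ be a positive, possibly infinite, measure on $\mathcal C_{\mathcal T}$. For $\mathcal A\subset\mathcal V$ let $\mathbb Q_{\mathcal A}$ be the image of $\mathbb Q$ under $X_{\mathcal A}=(X_v)_{v\in\mathcal A}$, and assume that $\mathbb Q_{\mathcal S}$ is $\sigma$-finite. For a probability measure $P$ and a $\sigma$-finite measure $Q$ on the same space put $\mathrm{KL}(P\Vert Q)=\int\log\frac{dP}{dQ}\,dP\in[-\infty,\infty]$ if $P\ll Q$ and the positive part of $\log\frac{dP}{dQ}$ is $P$-integrable, and $\mathrm{KL}(P\Vert Q)=+\infty$ otherwise. Consider the problems $$\min\{\mathrm{KL}(\mathbb P\Vert\mathbb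 Q):\mathbb P\in\mathcal P(\mathcal C_{\mathcal T}),\ \mathbb P_i=\mu_i\ \forall i\in\mathcal S\},\tag{dyn}$$ $$\min\{\mathrm{KL}(\Pi\Vert\mathbb Q_{\mathcal V}):\Pi\in\mathcal P((\mathbb R^d)^{\mathcal V}),\ \Pi_i=\mu_i\ \forall i\in\mathcal S\},\tag{stat}$$ $$\min\{\mathrm{KL}(\Pi\Vert\mathbb Q_{\mathcal S}):\Pi\in\mathcal P((\mathbb R^d)^{\mathcal S}),\ \Pi_i=\mu_i\ \forall i\in\mathcal S\}.\tag{stat-$\mathcal S$}$$ A solution is a feasible measure that attains the minimum, with a finite value of $\mathrm{KL}$. For $\mathcal A\in\{\mathcal V,\mathcal S\}$ the bridge $\mathbb Q_{\cdot|\mathcal A}$ denotes a regular conditional distribution of the path under $\mathbb Q$ given $X_{\mathcal A}$, that is, a Markov kernel with $\mathbb Q=\int\mathbb Q_{\cdot|\mathcal A}(\cdot|x)\,\mathbb Q_{\mathcal A}(dx)$ and with $X_{\mathcal A}=x$ holding $\mathbb Q_{\cdot|\mathcal A}(\cdot|x)$-almost surely for $\mathbb Q_{\mathcal A}$-a.e.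 $x$; and $\Pi\,\mathbb Q_{\cdot|\mathcal A}=\int\mathbb Q_{\cdot|\mathcal A}(\cdot|x)\,\Pi(dx)$. **Proposition.** 1. Each of the three problems has at most one solution. 2. If $\mathbb P$ solves (dyn), then $\mathbb P_{\mathcal V}$ solves (stat). Conversely, $\mathbb Q_{\cdot|\mathcal V}$ exists, and if $\Pi$ solves (stat), then $\Pi\,\mathbb Q_{\cdot|\mathcal V}$ solves (dyn), for every version of $\mathbb Q_{\cdot|\mathcal V}$. 3. If $\mathbb P$ solves (dyn), then $\mathbb P_{\mathcal S}$ solves (stat-$\mathcal S$). Conversely, $\mathbb Q_{\cdot|\mathcal S}$ exists, and if $\Pi$ solves (stat-$\mathcal S$), then $\Pi\,\mathbb Q_{\cdot|\mathcal S}$ solves (dyn), for every version of $\mathbb Q_{\cdot|\mathcal S}$. 4. Let $\sigma>0$, let $r\in\mathcal V$ be a root, let $m$ be a $\sigma$-finite measure on $\mathbb R^d$, and let $\mathbb Q$ be the Brownian reference measure, under which $X_r$ has marginal $m$ and, given $X_r$, independent Brownian motions $(\sigma B^e_t)_{t\in[0,T^e]}$ run along the edges oriented away from $r$ (here $\mathbb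 Q_{\mathcal S}$ is not assumed to be $\sigma$-finite). Then $\mathbb Q_{\cdot|\mathcal V}$ exists, and for $\mathbb Q_{\mathcal V}$-a.e. $x$ the measure $\mathbb Q_{\cdot|\mathcal V}(\cdot|x)$ is the law of independent Brownian bridges along the edges, the one on $e=(u,v)$ going from $x_u$ to $x_v$ in time $T^e$ with diffusion coefficient $\sigma$; so the mixture in part 2 is a mixture of Brownian bridges along the edges. If $m$ is Lebesgue measure and $\mathcal S\neq\emptyset$, then $\mathbb Q_{\mathcal S}$ is $\sigma$-finite, so that parts 1–3 apply to $\mathbb Q$. -/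

import Mathlib

open MeasureTheory ProbabilityTheory
open scoped ENNReal

noncomputable section

/-- A combinatorial tree with positive edge lengths (only the values of `len` on edges matter). -/
structure MetricTree (V : Type*) where
  graph : SimpleGraph V
  isTree : graph.IsTree
  len : Sym2 V → ℝ
  len_pos : ∀ e ∈ graph.edgeSet, 0 < len e

namespace MetricTree

variable {V : Type*} (T : MetricTree V)

/-- Disjoint union of the (discrete) vertex set and of one interval `[0, len d]` for each
oriented edge `d`; the two orientations of an edge are identified by `Glue` below. -/
def PreSpace : Type _ := V ⊕ (Σ d : T.graph.Dart, Set.Icc (0 : ℝ) (T.len d.edge))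

instance : TopologicalSpace T.PreSpace :=
  letI : TopologicalSpace V := ⊥
  inferInstanceAs (TopologicalSpace (V ⊕ (Σ d : T.graph.Dart, Set.Icc (0 : ℝ) (T.len d.edge))))

/-- The interval of an oriented edge starts at the source of the edge, and the point at time `s`
of an edge is the point at time `len - s` of the reversed edge. -/
inductive Glue : T.PreSpace → T.PreSpace → Prop
  | start (d : T.graph.Dart) (t : Set.Icc (0 : ℝ) (T.len d.edge)) (ht : (t : ℝ) = 0) :
      Glue (Sum.inr ⟨d, t⟩) (Sum.inl d.fst)
  | flip (d : T.graph.Dart) (s : Set.Icc (0 : ℝ) (T.len d.edge))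
      (t : Set.Icc (0 : ℝ) (T.len d.symm.edge)) (hst : (s : ℝ) + t = T.len d.edge) :
      Glue (Sum.inr ⟨d, s⟩) (Sum.inr ⟨d.symm, t⟩)

/-- The geometric realisation of the tree: every edge is a segment of its prescribed length,
and segments are attached to each other at the vertices. -/
def Space : Type _ := Quot T.Glue

instance : TopologicalSpace T.Space := inferInstanceAs (TopologicalSpace (Quot T.Glue))

/-- The point of the tree given by a vertex. -/
def vertex (v : V) : T.Space := Quot.mk _ (Sum.inl v)

/-- The point at distance `t` from the source on an oriented edge. -/
def edgePoint (d : T.graph.Dart) (t : Set.Icc (0 : ℝ) (T.len d.edge)) : T.Space :=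
  Quot.mk _ (Sum.inr ⟨d, t⟩)

/-- Continuous paths on the tree with values in `ℝⁿ`, with the topology of uniform convergence. -/
abbrev PathSpace (n : ℕ) : Type _ := C(T.Space, EuclideanSpace ℝ (Fin n))

instance (n : ℕ) : MeasurableSpace (T.PathSpace n) := borel _

instance (n : ℕ) : BorelSpace (T.PathSpace n) := ⟨rfl⟩

variable {n : ℕ} {ι : Type*}

/-- The values of a path at a family of vertices. -/
def values (f : ι → V) (ω : T.PathSpace n) : ι → EuclideanSpace ℝ (Fin n) :=
  fun i => ω (T.vertex (f i))

/-- The joint law of a path measure at a family of vertices. -/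
def jointLaw (f : ι → V) (P : Measure (T.PathSpace n)) :
    Measure (ι → EuclideanSpace ℝ (Fin n)) :=
  P.map (T.values f)

end MetricTree

open Classical in
/-- Relative entropy `∫ log (dP/dQ) dP` with respect to a possibly infinite measure `Q`, with
values in `[-∞, ∞]`: it is the integral of the positive part minus the integral of the negative
part, and it is `+∞` when `P` is not absolutely continuous with respect to `Q` or when the positive
part is not integrable. -/
def relEntropy {α : Type*} [MeasurableSpace α] (P Q : Measure α) : EReal :=
  if P ≪ Q ∧ ∫⁻ a, ENNReal.ofReal (llr P Q a) ∂P ≠ ∞ then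
    ((∫⁻ a, ENNReal.ofReal (llr P Q a) ∂P : ℝ≥0∞) : EReal)
      - ((∫⁻ a, ENNReal.ofReal (-llr P Q a) ∂P : ℝ≥0∞) : EReal)
  else ⊤

/-- `P` minimises the relative entropy with respect to `Q` over the set `C`, with a finite
minimal value. -/
def IsEntropyMinimizer {α : Type*} [MeasurableSpace α] (Q : Measure α) (C : Set (Measure α))
    (P : Measure α) : Prop :=
  P ∈ C ∧ relEntropy P Q ≠ ⊤ ∧ relEntropy P Q ≠ ⊥ ∧ ∀ P' ∈ C, relEntropy P Q ≤ relEntropy P' Q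

namespace MetricTree

variable {V : Type*} (T : MetricTree V) {n : ℕ} {ι : Type*} (S : Set V)
  (μ : S → Measure (EuclideanSpace ℝ (Fin n)))

/-- `P` solves the dynamic tree-structured Schrödinger bridge problem. -/
def SolvesDynamic (Q P : Measure (T.PathSpace n)) : Prop :=
  IsEntropyMinimizer Q
    {P | IsProbabilityMeasure P ∧ ∀ i : S, P.map (fun ω => ω (T.vertex i)) = μ i} P

/-- `R` solves the static problem over all vertices. -/
def SolvesStatic (Q : Measure (T.PathSpace n)) (R : Measure (V → EuclideanSpace ℝ (Fin n))) :
    Prop :=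
  IsEntropyMinimizer (T.jointLaw (fun v : V => v) Q)
    {R | IsProbabilityMeasure R ∧ ∀ i : S, R.map (fun x => x i) = μ i} R

/-- `R` solves the static problem over the observed vertices `S`. -/
def SolvesStaticOn (Q : Measure (T.PathSpace n)) (R : Measure (S → EuclideanSpace ℝ (Fin n))) :
    Prop :=
  IsEntropyMinimizer (T.jointLaw (fun i : S => (i : V)) Q)
    {R | IsProbabilityMeasure R ∧ ∀ i : S, R.map (fun x => x i) = μ i} R

/-- `K` is a version of the bridges of `Q`, that is, a regular conditional distribution under `Q`
of the path given its values at the vertices `f i`. -/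
def IsBridgeKernel (f : ι → V) (Q : Measure (T.PathSpace n))
    (K : Kernel (ι → EuclideanSpace ℝ (Fin n)) (T.PathSpace n)) : Prop :=
  IsMarkovKernel K ∧ (T.jointLaw f Q).bind K = Q ∧
    ∀ᵐ x ∂(T.jointLaw f Q), ∀ᵐ ω ∂(K x), T.values f ω = x

/-- `W` is the law of the process on the tree that vanishes at the root `r` and runs independent
Brownian motions with diffusion coefficient `σ` along the edges oriented away from `r`. -/
structure IsTreeBrownianFromZero (r : V) (σ : ℝ) (W : Measure (T.PathSpace n)) : Prop where
  isProbabilityMeasure : IsProbabilityMeasure W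
  root : ∀ᵐ ω ∂W, ω (T.vertex r) = 0
  gaussian : IsGaussianProcess (fun (p : T.Space) (ω : T.PathSpace n) => ω p) W
  mean : ∀ p : T.Space, ∫ ω, ω p ∂W = 0
  cov_same : ∀ d : T.graph.Dart, T.graph.dist r d.fst < T.graph.dist r d.snd →
    ∀ (s t : Set.Icc (0 : ℝ) (T.len d.edge)) (i j : Fin n),
      covariance (fun ω : T.PathSpace n => (ω (T.edgePoint d s) - ω (T.vertex d.fst)) i)
        (fun ω => (ω (T.edgePoint d t) - ω (T.vertex d.fst)) j) W
      = if i = j then σ ^ 2 * min (s : ℝ) t else 0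
  cov_ne : ∀ d d' : T.graph.Dart, T.graph.dist r d.fst < T.graph.dist r d.snd →
    T.graph.dist r d'.fst < T.graph.dist r d'.snd → d ≠ d' →
    ∀ (s : Set.Icc (0 : ℝ) (T.len d.edge)) (t : Set.Icc (0 : ℝ) (T.len d'.edge)) (i j : Fin n),
      covariance (fun ω : T.PathSpace n => (ω (T.edgePoint d s) - ω (T.vertex d.fst)) i)
        (fun ω => (ω (T.edgePoint d' t) - ω (T.vertex d'.fst)) j) W = 0

/-- `Q` is the (possibly infinite) measure with root marginal `m` under which independent
Brownian motions with diffusion coefficient `σ` run along the edges away from the root. -/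
def IsBrownianReference (r : V) (σ : ℝ) (m : Measure (EuclideanSpace ℝ (Fin n)))
    (Q : Measure (T.PathSpace n)) : Prop :=
  ∃ W : Measure (T.PathSpace n), T.IsTreeBrownianFromZero r σ W ∧
    Q = (m.prod W).map (fun p => ContinuousMap.const T.Space p.1 + p.2)

/-- `P` is the law of independent Brownian bridges with diffusion coefficient `σ` along the
edges, with prescribed values `x` at the vertices. -/
structure IsEdgewiseBrownianBridge (σ : ℝ) (x : V → EuclideanSpace ℝ (Fin n))
    (P : Measure (T.PathSpace n)) : Prop where
  isProbabilityMeasure : IsProbabilityMeasure P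
  vertex_eq : ∀ v, ∀ᵐ ω ∂P, ω (T.vertex v) = x v
  gaussian : IsGaussianProcess (fun (p : T.Space) (ω : T.PathSpace n) => ω p) P
  mean : ∀ (d : T.graph.Dart) (t : Set.Icc (0 : ℝ) (T.len d.edge)),
    ∫ ω, ω (T.edgePoint d t) ∂P = x d.fst + ((t : ℝ) / T.len d.edge) • (x d.snd - x d.fst)
  cov_same : ∀ (d : T.graph.Dart) (s t : Set.Icc (0 : ℝ) (T.len d.edge)), s ≤ t →
    ∀ i j : Fin n,
      covariance (fun ω : T.PathSpace n => ω (T.edgePoint d s) i)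
        (fun ω => ω (T.edgePoint d t) j) P
      = if i = j then σ ^ 2 * (s * (T.len d.edge - t) / T.len d.edge) else 0
  cov_ne : ∀ d d' : T.graph.Dart, d.edge ≠ d'.edge →
    ∀ (s : Set.Icc (0 : ℝ) (T.len d.edge)) (t : Set.Icc (0 : ℝ) (T.len d'.edge)) (i j : Fin n),
      covariance (fun ω : T.PathSpace n => ω (T.edgePoint d s) i)
        (fun ω => ω (T.edgePoint d' t) j) P = 0

end MetricTree

end

/-! Parts 1–3 rest on the chain rule for relative entropy along a measurable map `f`. Given `P`, let
`L` be the measure with density `d(f_*P)/d(f_*Q) ∘ f` with respect to `Q` (`liftAlong`): it has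
image `f_*P` and the conditional distributions of `Q` given `f`. Formally `KL(P‖Q) = KL(P‖L) +
KL(f_*P‖f_*Q)`, where `KL(P‖L) ≥ 0`, so passing to images does not increase entropy
(`relEntropy_map_le`), while lifts preserve it (`relEntropy_liftAlong`). If the constraint sees `P`
only through `f_*P`, minimisers upstairs and downstairs therefore correspond, and the lift of `N` is
`N.bind K` for every disintegration kernel `K`. This is applied to the values at all vertices and at
the vertices of `S`. Since `Q` may be infinite, the value `-∞` can occur, and each use of the chain
rule first settles integrability.

Uniqueness comes from the midpoint `M` of two minimisers: `KL(P‖Q) + KL(P'‖Q) = 2 KL(M‖Q) + KL(P‖M)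
+ KL(P'‖M)`.

For the Brownian reference, subtract from a path the linear interpolation of its vertex values. The
remainder is uncorrelated with the vertex values, hence independent of them by Gaussianity, and has
the covariance of independent bridges. A random constant start changes only the vertex values, so `x
↦` law of (interpolation of `x` + remainder) disintegrates `Q` (`isBridgeKernel`); other versions
agree with it almost everywhere. -/

section RelativeEntropy

/-! ### Relative entropy: chain rule, monotonicity under images, uniqueness of minimisers. -/

variable {α β : Type*} {mα : MeasurableSpace α} {mβ : MeasurableSpace β}

lemma integrable_of_lintegral_ofReal_ne_top {P : Measure α} {g : α → ℝ}
    (hg : AEStronglyMeasurable g P) (hpos : ∫⁻ a, ENNReal.ofReal (g a) ∂P ≠ ∞)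
    (hneg : ∫⁻ a, ENNReal.ofReal (-g a) ∂P ≠ ∞) : Integrable g P := by
  refine ⟨hg, ?_⟩
  have hle : ∫⁻ a, ‖g a‖ₑ ∂P
      ≤ ∫⁻ a, (ENNReal.ofReal (g a) + ENNReal.ofReal (-g a)) ∂P := by
    refine lintegral_mono fun a => ?_
    rw [Real.enorm_eq_ofReal_abs]
    rcases le_total 0 (g a) with h | h
    · rw [abs_of_nonneg h]; exact le_self_add
    · rw [abs_of_nonpos h]; exact le_add_self
  rw [lintegral_add_left' hg.aemeasurable.ennreal_ofReal] at hle
  exact hle.trans_lt (ENNReal.add_lt_top.2 ⟨hpos.lt_top, hneg.lt_top⟩)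

lemma lintegral_ofReal_ne_top_of_integrable {P : Measure α} {g : α → ℝ} (hg : Integrable g P) :
    ∫⁻ a, ENNReal.ofReal (g a) ∂P ≠ ∞ := by
  refine ((lintegral_mono fun a => ?_).trans_lt hg.2).ne
  rw [Real.enorm_eq_ofReal_abs]
  exact ENNReal.ofReal_le_ofReal (le_abs_self _)

lemma lintegral_ofReal_add_ne_top {P : Measure α} {g h k : α → ℝ} (hh : Measurable h)
    (hgk : ∀ᵐ a ∂P, g a ≤ h a + k a) (h1 : ∫⁻ a, ENNReal.ofReal (h a) ∂P ≠ ∞)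
    (h2 : ∫⁻ a, ENNReal.ofReal (k a) ∂P ≠ ∞) : ∫⁻ a, ENNReal.ofReal (g a) ∂P ≠ ∞ := by
  have hle : ∫⁻ a, ENNReal.ofReal (g a) ∂P
      ≤ ∫⁻ a, (ENNReal.ofReal (h a) + ENNReal.ofReal (k a)) ∂P := by
    refine lintegral_mono_ae ?_
    filter_upwards [hgk] with a ha
    exact (ENNReal.ofReal_le_ofReal ha).trans ENNReal.ofReal_add_le
  rw [lintegral_add_left hh.ennreal_ofReal] at hle
  exact (hle.trans_lt (ENNReal.add_lt_top.2 ⟨h1.lt_top, h2.lt_top⟩)).ne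

lemma relEntropy_ne_top_iff {P Q : Measure α} :
    relEntropy P Q ≠ ⊤ ↔ P ≪ Q ∧ ∫⁻ a, ENNReal.ofReal (llr P Q a) ∂P ≠ ∞ := by
  unfold relEntropy
  split_ifs with h
  · refine ⟨fun _ => h, fun _ => ?_⟩
    rw [sub_eq_add_neg]
    refine EReal.add_ne_top ?_ ?_
    · simpa using h.2
    · simp
  · simp only [ne_eq, not_true_eq_false, false_iff]; exact h

lemma relEntropy_eq_integral {P Q : Measure α} (hPQ : P ≪ Q) (h : Integrable (llr P Q) P) :
    relEntropy P Q = ((∫ a, llr P Q a ∂P : ℝ) : EReal) := by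
  have h1 := lintegral_ofReal_ne_top_of_integrable h
  have h2 := lintegral_ofReal_ne_top_of_integrable h.neg
  rw [relEntropy, if_pos ⟨hPQ, h1⟩, integral_eq_lintegral_pos_part_sub_lintegral_neg_part h,
    EReal.coe_sub, EReal.coe_ennreal_toReal h1]
  congr 1
  exact (EReal.coe_ennreal_toReal h2).symm

/-- Once the positive part is integrable, integrability can fail only through an infinite negative
part. -/
lemma relEntropy_eq_bot_of_not_integrable {P Q : Measure α} (hPQ : P ≪ Q)
    (h : ∫⁻ a, ENNReal.ofReal (llr P Q a) ∂P ≠ ∞) (hn : ¬ Integrable (llr P Q) P) :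
    relEntropy P Q = ⊥ := by
  have h2 : ∫⁻ a, ENNReal.ofReal (-llr P Q a) ∂P = ∞ := by
    by_contra h2
    exact hn (integrable_of_lintegral_ofReal_ne_top
      (measurable_llr P Q).aestronglyMeasurable h h2)
  rw [relEntropy, if_pos ⟨hPQ, h⟩, h2, EReal.coe_ennreal_top, EReal.sub_top]

lemma integrable_llr_of_relEntropy_ne {P Q : Measure α} (h1 : relEntropy P Q ≠ ⊤)
    (h2 : relEntropy P Q ≠ ⊥) : P ≪ Q ∧ Integrable (llr P Q) P := by
  obtain ⟨hPQ, h⟩ := relEntropy_ne_top_iff.1 h1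
  exact ⟨hPQ, by_contra fun hn => h2 (relEntropy_eq_bot_of_not_integrable hPQ h hn)⟩

lemma llr_chain {P N Q : Measure α} [SigmaFinite P] [SigmaFinite N] [SigmaFinite Q]
    (hPR : P ≪ N) (hRQ : N ≪ Q) : ∀ᵐ a ∂P, llr P Q a = llr P N a + llr N Q a := by
  filter_upwards [(hPR.trans hRQ).ae_le (Measure.rnDeriv_mul_rnDeriv (κ := Q) hPR),
    Measure.rnDeriv_pos hPR, hPR.ae_le (Measure.rnDeriv_ne_top P N),
    hPR.ae_le (Measure.rnDeriv_pos hRQ), (hPR.trans hRQ).ae_le (Measure.rnDeriv_ne_top N Q)]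
    with a h h1 h2 h3 h4
  simp only [llr_def, ← h, Pi.mul_apply, ENNReal.toReal_mul]
  exact Real.log_mul (ENNReal.toReal_pos h1.ne' h2).ne' (ENNReal.toReal_pos h3.ne' h4).ne'

lemma lintegral_ofReal_neg_llr_ne_top {P N : Measure α} [SigmaFinite P] [IsFiniteMeasure N]
    (hPR : P ≪ N) : ∫⁻ a, ENNReal.ofReal (-llr P N a) ∂P ≠ ∞ := by
  have hle : ∫⁻ a, ENNReal.ofReal (-llr P N a) ∂P ≤ ∫⁻ _, (1 : ℝ≥0∞) ∂N := by
    have hm : Measurable fun a => ENNReal.ofReal (-llr P N a) :=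
      (measurable_llr P N).neg.ennreal_ofReal
    rw [← lintegral_rnDeriv_mul hPR hm.aemeasurable]
    refine lintegral_mono_ae ?_
    filter_upwards [Measure.rnDeriv_ne_top P N] with a ha
    rw [llr_def]
    set p := P.rnDeriv N a
    rcases eq_or_ne p 0 with h0 | h0
    · simp [h0]
    have hp : 0 < p.toReal := ENNReal.toReal_pos h0 ha
    nth_rewrite 1 [← ENNReal.ofReal_toReal ha]
    rw [← ENNReal.ofReal_mul hp.le, ← ENNReal.ofReal_one]
    refine ENNReal.ofReal_le_ofReal ?_
    -- With `p = dP/dN`, multiplying `1 - 1/p ≤ log p` by `p` gives `-p log p ≤ 1 - p ≤ 1`, which is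
    -- integrable because `N` is finite.
    have h := Real.one_sub_inv_le_log_of_pos hp
    have h' := mul_le_mul_of_nonneg_left h hp.le
    rw [mul_sub, mul_inv_cancel₀ hp.ne'] at h'
    linarith
  refine (hle.trans_lt ?_).ne
  simp

lemma map_withDensity_comp {f : α → β} (hf : Measurable f) (Q : Measure α) {g : β → ℝ≥0∞}
    (hg : Measurable g) : (Q.withDensity (g ∘ f)).map f = (Q.map f).withDensity g := by
  ext s hs
  rw [Measure.map_apply hf hs, withDensity_apply _ (hf hs), withDensity_apply _ hs,
    setLIntegral_map hs hg hf]
  rfl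

/-- The measure with the same disintegration along `f` as `Q` and with image `N` under `f`. -/
noncomputable def liftAlong (f : α → β) (Q : Measure α) (N : Measure β) : Measure α :=
  Q.withDensity (N.rnDeriv (Q.map f) ∘ f)

lemma liftAlong_absolutelyContinuous {f : α → β} {Q : Measure α} {N : Measure β} :
    liftAlong f Q N ≪ Q := withDensity_absolutelyContinuous _ _

section Lift

variable {f : α → β} {Q : Measure α} [SigmaFinite (Q.map f)] {N : Measure β}

lemma map_liftAlong [SigmaFinite N] (hf : Measurable f) (hR : N ≪ Q.map f) : (liftAlong f Q N).map f = N := by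
  rw [liftAlong, map_withDensity_comp hf Q (Measure.measurable_rnDeriv _ _),
    Measure.withDensity_rnDeriv_eq _ _ hR]

lemma isProbabilityMeasure_liftAlong [IsProbabilityMeasure N] (hf : Measurable f)
    (hR : N ≪ Q.map f) : IsProbabilityMeasure (liftAlong f Q N) := by
  refine (Measure.isProbabilityMeasure_map_iff hf.aemeasurable).1 ?_
  rwa [map_liftAlong hf hR]

lemma llr_liftAlong (hf : Measurable f) :
    ∀ᵐ a ∂Q, llr (liftAlong f Q N) Q a = llr N (Q.map f) (f a) := by
  have := SigmaFinite.of_map Q hf.aemeasurable inferInstance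
  filter_upwards [Measure.rnDeriv_withDensity Q
    ((Measure.measurable_rnDeriv N (Q.map f)).comp hf)] with a ha
  simp only [llr_def, liftAlong, ha, Function.comp_apply]

/-- The density of the lift vanishes only where that of `P.map f`, composed with `f`, does, and this
set is `P`-null. -/
lemma absolutelyContinuous_liftAlong {P : Measure α} [IsProbabilityMeasure P] (hf : Measurable f)
    (hPQ : P ≪ Q) : P ≪ liftAlong f Q (P.map f) := by
  have := Measure.isProbabilityMeasure_map (μ := P) hf.aemeasurable
  have hpos : ∀ᵐ a ∂P, 0 < (P.map f).rnDeriv (Q.map f) (f a) :=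
    ae_of_ae_map hf.aemeasurable (Measure.rnDeriv_pos (hPQ.map hf))
  refine Measure.AbsolutelyContinuous.mk fun s _ h => ?_
  rw [liftAlong, withDensity_apply_eq_zero ((Measure.measurable_rnDeriv _ _).comp hf)] at h
  refine measure_mono_null (fun a ha => ?_) (measure_union_null (hPQ h) hpos)
  by_cases h0 : (P.map f).rnDeriv (Q.map f) (f a) = 0
  · right; simp [h0]
  · left; exact ⟨h0, ha⟩

/-- The log-density of the lift factors through `f`, so its positive and negative parts are
integrated by change of variables. -/
lemma relEntropy_liftAlong [IsProbabilityMeasure N] (hf : Measurable f) (hR : N ≪ Q.map f) :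
    relEntropy (liftAlong f Q N) Q = relEntropy N (Q.map f) := by
  have hllr : ∀ᵐ a ∂(liftAlong f Q N), llr (liftAlong f Q N) Q a = llr N (Q.map f) (f a) :=
    liftAlong_absolutelyContinuous.ae_le (llr_liftAlong hf)
  have key : ∀ φ : ℝ → ℝ, Measurable φ →
      ∫⁻ a, ENNReal.ofReal (φ (llr (liftAlong f Q N) Q a)) ∂(liftAlong f Q N)
        = ∫⁻ b, ENNReal.ofReal (φ (llr N (Q.map f) b)) ∂N := by
    intro φ hφ
    calc _ = ∫⁻ a, ENNReal.ofReal (φ (llr N (Q.map f) (f a))) ∂(liftAlong f Q N) := by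
          refine lintegral_congr_ae ?_
          filter_upwards [hllr] with a ha
          rw [ha]
      _ = ∫⁻ b, ENNReal.ofReal (φ (llr N (Q.map f) b)) ∂((liftAlong f Q N).map f) :=
          (lintegral_map (hφ.comp (measurable_llr _ _)).ennreal_ofReal hf).symm
      _ = _ := by rw [map_liftAlong hf hR]
  have h1 := key id measurable_id
  have h2 := key (fun x => -x) measurable_neg
  simp only [id] at h1
  unfold relEntropy
  simp only [h1, h2, hR, liftAlong_absolutelyContinuous]

lemma relEntropy_map_le {P : Measure α} [IsProbabilityMeasure P] (hf : Measurable f) :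
    relEntropy (P.map f) (Q.map f) ≤ relEntropy P Q := by
  by_cases htop : relEntropy P Q = ⊤
  · rw [htop]; exact le_top
  have := SigmaFinite.of_map Q hf.aemeasurable inferInstance
  have := Measure.isProbabilityMeasure_map (μ := P) hf.aemeasurable
  obtain ⟨hPQ, hpos⟩ := relEntropy_ne_top_iff.1 htop
  have hR : P.map f ≪ Q.map f := hPQ.map hf
  have := isProbabilityMeasure_liftAlong hf hR
  have hPL := absolutelyContinuous_liftAlong hf hPQ
  set L := liftAlong f Q (P.map f)
  have hLQ : L ≪ Q := liftAlong_absolutelyContinuous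
  have hchain : ∀ᵐ a ∂P, llr P Q a = llr P L a + llr (P.map f) (Q.map f) (f a) := by
    filter_upwards [llr_chain hPL hLQ, hPQ.ae_le (llr_liftAlong hf)] with a h1 h2
    rw [h1, h2]
  have hneg := lintegral_ofReal_neg_llr_ne_top hPL
  have hmeas := measurable_llr (P.map f) (Q.map f)
  -- The log-density of the images is `llr P Q - llr P L`; its positive part is controlled by those
  -- of `llr P Q` and `-llr P L`, the latter because `L` is finite.
  have hApos : ∫⁻ b, ENNReal.ofReal (llr (P.map f) (Q.map f) b) ∂(P.map f) ≠ ∞ := by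
    rw [lintegral_map hmeas.ennreal_ofReal hf]
    refine lintegral_ofReal_add_ne_top (measurable_llr P Q) ?_ hpos hneg
    filter_upwards [hchain] with a ha
    linarith
  by_cases hint : Integrable (llr (P.map f) (Q.map f)) (P.map f)
  · have hint' := (integrable_map_measure hmeas.aestronglyMeasurable hf.aemeasurable).1 hint
    have hintL : Integrable (llr P L) P := by
      refine integrable_of_lintegral_ofReal_ne_top (measurable_llr P L).aestronglyMeasurable
        (lintegral_ofReal_add_ne_top (measurable_llr P Q) ?_ hpos
          (lintegral_ofReal_ne_top_of_integrable hint'.neg)) hneg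
      filter_upwards [hchain] with a ha
      simp only [Pi.neg_apply, Function.comp_apply]
      linarith
    have hintQ : Integrable (llr P Q) P :=
      (hintL.add hint').congr (hchain.mono fun a ha => ha.symm)
    rw [relEntropy_eq_integral hR hint, relEntropy_eq_integral hPQ hintQ, EReal.coe_le_coe_iff,
      integral_map hf.aemeasurable hmeas.aestronglyMeasurable, integral_congr_ae hchain,
      integral_add (g := fun a => llr (P.map f) (Q.map f) (f a)) hintL hint']
    have h := InformationTheory.integral_llr_add_sub_measure_univ_nonneg hPL hintL
    simp only [probReal_univ] at h
    linarith
  -- The image entropy is then `⊥`, and there is nothing to compare.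
  · rw [relEntropy_eq_bot_of_not_integrable hR hApos hint]
    exact bot_le

end Lift

lemma rnDeriv_le_of_le_smul {P M : Measure α} [SigmaFinite P] [SigmaFinite M] {c : ℝ≥0∞}
    (h : P ≤ c • M) : ∀ᵐ a ∂M, P.rnDeriv M a ≤ c := by
  refine ae_le_of_forall_setLIntegral_le_of_sigmaFinite (Measure.measurable_rnDeriv _ _)
    fun s hs _ => ?_
  calc ∫⁻ a in s, P.rnDeriv M a ∂M ≤ P s := Measure.setLIntegral_rnDeriv_le s
    _ ≤ (c • M) s := h s
    _ = ∫⁻ _ in s, c ∂M := by simp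

lemma integrable_llr_of_le_smul {P M : Measure α} [IsFiniteMeasure P]
    [IsFiniteMeasure M] {c : ℝ≥0∞}
    (hc : c ≠ ∞) (h : P ≤ c • M) : P ≪ M ∧ Integrable (llr P M) P := by
  have hPM : P ≪ M := (Measure.absolutelyContinuous_of_le h).trans
    (Measure.smul_absolutelyContinuous)
  refine ⟨hPM, integrable_of_lintegral_ofReal_ne_top (measurable_llr P M).aestronglyMeasurable ?_
    (lintegral_ofReal_neg_llr_ne_top hPM)⟩
  have hle : ∫⁻ a, ENNReal.ofReal (llr P M a) ∂P ≤ ∫⁻ _, c ∂P := by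
    refine lintegral_mono_ae ?_
    filter_upwards [hPM.ae_le (rnDeriv_le_of_le_smul h)] with a ha
    refine ENNReal.ofReal_le_of_le_toReal ?_
    refine (Real.log_le_self ENNReal.toReal_nonneg).trans ?_
    exact ENNReal.toReal_mono hc ha
  refine (hle.trans_lt ?_).ne
  rw [lintegral_const]
  exact ENNReal.mul_lt_top hc.lt_top (measure_lt_top _ _)

/-- A minimiser of the relative entropy over a set of probability measures that is stable under
midpoints is unique. -/
lemma IsEntropyMinimizer.unique {Q : Measure α} [SigmaFinite Q] {C : Set (Measure α)}
    (hprob : ∀ P ∈ C, IsProbabilityMeasure P)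
    (hmid : ∀ P ∈ C, ∀ P' ∈ C, (2⁻¹ : ℝ≥0∞) • P + (2⁻¹ : ℝ≥0∞) • P' ∈ C) {P P' : Measure α}
    (h : IsEntropyMinimizer Q C P) (h' : IsEntropyMinimizer Q C P') : P = P' := by
  obtain ⟨hC, h1, h2, hmin⟩ := h
  obtain ⟨hC', h1', h2', hmin'⟩ := h'
  have heq : relEntropy P Q = relEntropy P' Q := le_antisymm (hmin _ hC') (hmin' _ hC)
  obtain ⟨hPQ, hint⟩ := integrable_llr_of_relEntropy_ne h1 h2
  obtain ⟨hPQ', hint'⟩ := integrable_llr_of_relEntropy_ne h1' h2'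
  have hCM := hmid P hC P' hC'
  set M := (2⁻¹ : ℝ≥0∞) • P + (2⁻¹ : ℝ≥0∞) • P' with hM
  have := hprob _ hC
  have := hprob _ hC'
  have := hprob _ hCM
  have h2M : (2 : ℝ≥0∞) • M = P + P' := by
    rw [hM, smul_add, smul_smul, smul_smul, ENNReal.mul_inv_cancel two_ne_zero (by simp),
      one_smul, one_smul]
  have hle : P ≤ (2 : ℝ≥0∞) • M := h2M ▸ Measure.le_add_right le_rfl
  have hle' : P' ≤ (2 : ℝ≥0∞) • M := h2M ▸ Measure.le_add_left le_rfl
  have hMQ : M ≪ Q := (hPQ.smul_left _).add_left (hPQ'.smul_left _)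
  -- `dP/dM ≤ 2`, so the entropies relative to the midpoint are automatically finite.
  obtain ⟨hPM, hiM⟩ := integrable_llr_of_le_smul (by simp) hle
  obtain ⟨hPM', hiM'⟩ := integrable_llr_of_le_smul (by simp) hle'
  have hc := llr_chain hPM hMQ
  have hc' := llr_chain hPM' hMQ
  have hi : Integrable (llr M Q) P :=
    (hint.sub hiM).congr (hc.mono fun a ha => by simp only [Pi.sub_apply]; linarith)
  have hi' : Integrable (llr M Q) P' :=
    (hint'.sub hiM').congr (hc'.mono fun a ha => by simp only [Pi.sub_apply]; linarith)
  have hMint : Integrable (llr M Q) M :=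
    (hi.smul_measure (by simp)).add_measure (hi'.smul_measure (by simp))
  have hsum : ∫ a, llr M Q a ∂M = 2⁻¹ * ∫ a, llr M Q a ∂P + 2⁻¹ * ∫ a, llr M Q a ∂P' := by
    nth_rewrite 2 [hM]
    rw [integral_add_measure (hi.smul_measure (by simp)) (hi'.smul_measure (by simp)),
      integral_smul_measure, integral_smul_measure]
    simp
  have e : ∫ a, llr P Q a ∂P = ∫ a, llr P M a ∂P + ∫ a, llr M Q a ∂P := by
    rw [integral_congr_ae hc, integral_add hiM hi]
  have e' : ∫ a, llr P' Q a ∂P' = ∫ a, llr P' M a ∂P' + ∫ a, llr M Q a ∂P' := by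
    rw [integral_congr_ae hc', integral_add hiM' hi']
  -- Averaging `e` and `e'`, the common minimum is the entropy of `M` plus half the sum of two
  -- nonnegative divergences; minimality forces both divergences to vanish.
  have hge := hmin _ hCM
  rw [relEntropy_eq_integral hPQ hint, relEntropy_eq_integral hMQ hMint,
    EReal.coe_le_coe_iff] at hge
  rw [relEntropy_eq_integral hPQ hint, relEntropy_eq_integral hPQ' hint',
    EReal.coe_eq_coe_iff] at heq
  have p := InformationTheory.integral_llr_add_sub_measure_univ_nonneg hPM hiM
  have p' := InformationTheory.integral_llr_add_sub_measure_univ_nonneg hPM' hiM'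
  simp only [probReal_univ] at p p'
  have aux : ∀ P : Measure α, IsProbabilityMeasure P → P ≪ M → Integrable (llr P M) P →
      ∫ a, llr P M a ∂P = 0 → P = M := by
    intro P _ hP hI h0
    refine InformationTheory.klDiv_eq_zero_iff.1 ?_
    rw [InformationTheory.klDiv_of_ac_of_integrable hP hI, h0]
    simp
  rw [aux P inferInstance hPM hiM (by linarith), aux P' inferInstance hPM' hiM' (by linarith)]

end RelativeEntropy

/-! ### Regular conditional distributions for measures with σ-finite image. -/

section FiberKernel

variable {α β : Type*} {mα : MeasurableSpace α} {mβ : MeasurableSpace β}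

/-- `K` is a regular conditional distribution of `Q` given `f`. -/
def IsFiberKernel (f : α → β) (Q : Measure α) (K : Kernel β α) : Prop :=
  IsMarkovKernel K ∧ (Q.map f).bind K = Q ∧ ∀ᵐ x ∂(Q.map f), ∀ᵐ a ∂(K x), f a = x

namespace IsFiberKernel

variable {f : α → β} {Q : Measure α} {K K' : Kernel β α}

/-- On the fibre over `x` the density `g ∘ f` is the constant `g x`, so reweighting commutes with
mixing the kernel. -/
lemma bind_withDensity (h : IsFiberKernel f Q K) (hf : Measurable f) {g : β → ℝ≥0∞}
    (hg : Measurable g) : ((Q.map f).withDensity g).bind K = Q.withDensity (g ∘ f) := by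
  obtain ⟨_, hb, hfib⟩ := h
  ext s hs
  rw [Measure.bind_apply hs K.aemeasurable, withDensity_apply _ hs,
    lintegral_withDensity_eq_lintegral_mul _ hg (K.measurable_coe hs),
    ← lintegral_indicator hs]
  nth_rewrite 2 [← hb]
  rw [Measure.lintegral_bind K.aemeasurable ((hg.comp hf).indicator hs).aemeasurable]
  refine lintegral_congr_ae ?_
  filter_upwards [hfib] with x hx
  have : ∫⁻ a, s.indicator (g ∘ f) a ∂(K x) = ∫⁻ a, s.indicator (fun _ => g x) a ∂(K x) := by
    refine lintegral_congr_ae ?_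
    filter_upwards [hx] with a ha
    by_cases hs' : a ∈ s <;> simp [hs', ha]
  rw [this, lintegral_indicator hs, setLIntegral_const]
  rfl

lemma bind_eq_liftAlong [SigmaFinite (Q.map f)] (h : IsFiberKernel f Q K) (hf : Measurable f)
    {N : Measure β} [SigmaFinite N] (hN : N ≪ Q.map f) : N.bind K = liftAlong f Q N := by
  nth_rewrite 1 [← Measure.withDensity_rnDeriv_eq _ _ hN]
  exact h.bind_withDensity hf (Measure.measurable_rnDeriv _ _)

lemma withDensity (h : IsFiberKernel f Q K) (hf : Measurable f) {g : β → ℝ≥0∞}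
    (hg : Measurable g) : IsFiberKernel f (Q.withDensity (g ∘ f)) K := by
  refine ⟨h.1, ?_, ?_⟩
  · rw [map_withDensity_comp hf Q hg, h.bind_withDensity hf hg]
  · rw [map_withDensity_comp hf Q hg]
    exact (withDensity_absolutelyContinuous _ _).ae_le h.2.2

lemma compProd_eq [SFinite (Q.map f)] (h : IsFiberKernel f Q K) (hf : Measurable f) :
    (Q.map f) ⊗ₘ K = Q.map fun a => (f a, a) := by
  obtain ⟨_, hb, hfib⟩ := h
  have hm : Measurable fun a => (f a, a) := hf.prodMk measurable_id
  ext s hs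
  rw [Measure.compProd_apply hs, Measure.map_apply hm hs]
  conv_rhs => rw [← hb]
  rw [Measure.bind_apply (hm hs) K.aemeasurable]
  refine lintegral_congr_ae ?_
  filter_upwards [hfib] with x hx
  refine measure_congr ?_
  filter_upwards [hx] with a ha
  simp only [eq_iff_iff]
  change (x, a) ∈ s ↔ (f a, a) ∈ s
  rw [ha]

end IsFiberKernel

/-- Reweighting by `w ∘ f` makes the measure finite without changing null sets or conditional
distributions, which reduces the σ-finite case to the finite one. -/
lemma exists_measurable_density (N : Measure β) [SigmaFinite N] :
    ∃ w : β → ℝ≥0∞, Measurable w ∧ (∀ x, w x ≠ 0) ∧ (∀ x, w x ≠ ∞) ∧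
      IsFiniteMeasure (N.withDensity w) := by
  obtain ⟨w, hpos, hw, hlt⟩ := exists_pos_lintegral_lt_of_sigmaFinite N one_ne_zero
  exact ⟨fun x => w x, hw.coe_nnreal_ennreal, fun x => by simpa using (hpos x).ne',
    fun x => ENNReal.coe_ne_top, isFiniteMeasure_withDensity (hlt.trans ENNReal.one_lt_top).ne⟩

namespace IsFiberKernel

variable {f : α → β} {Q : Measure α} {K K' : Kernel β α}

lemma ae_eq [SigmaFinite (Q.map f)] [MeasurableSpace.CountableOrCountablyGenerated β α]
    (h : IsFiberKernel f Q K) (h' : IsFiberKernel f Q K') (hf : Measurable f) :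
    ∀ᵐ x ∂(Q.map f), K x = K' x := by
  obtain ⟨w, hw, h0, -, hfin⟩ := exists_measurable_density (Q.map f)
  have hmap := map_withDensity_comp hf Q hw
  have hac : Q.map f ≪ (Q.map f).withDensity w :=
    withDensity_absolutelyContinuous' hw.aemeasurable (.of_forall h0)
  rw [← hmap] at hac hfin
  have := h.1
  have := h'.1
  refine hac.ae_le (Kernel.ae_eq_of_compProd_eq ?_)
  rw [(h.withDensity hf hw).compProd_eq hf, (h'.withDensity hf hw).compProd_eq hf]

lemma exists_of_sigmaFinite [SigmaFinite (Q.map f)] [StandardBorelSpace α] [Nonempty α]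
    [MeasurableEq β] (hf : Measurable f) :
    ∃ K : Kernel β α, IsFiberKernel f Q K := by
  obtain ⟨w, hw, h0, ht, hfin⟩ := exists_measurable_density (Q.map f)
  have hmap := map_withDensity_comp hf Q hw
  have hQ : IsFiniteMeasure (Q.withDensity (w ∘ f)) := by
    rw [← hmap] at hfin
    exact ⟨by have := hfin.1; rwa [Measure.map_apply hf MeasurableSet.univ] at this⟩
  have hK : IsFiberKernel f (Q.withDensity (w ∘ f))
      (condDistrib id f (Q.withDensity (w ∘ f))) := by
    refine ⟨inferInstance, ?_, ?_⟩
    · simpa using condDistrib_comp_map hf.aemeasurable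
        (measurable_id.aemeasurable (μ := Q.withDensity (w ∘ f)))
    -- Under the joint law of `f` and the identity, concentration on fibres reads `f a = f a`.
    · refine Measure.ae_ae_of_ae_compProd (p := fun z => f z.2 = z.1) ?_
      rw [compProd_map_condDistrib measurable_id.aemeasurable, ae_map_iff
        (hf.prodMk measurable_id).aemeasurable (p := fun z => f z.2 = z.1)
        (measurableSet_eq_fun (hf.comp measurable_snd) measurable_fst)]
      exact .of_forall fun _ => rfl
  have h2 := hK.withDensity hf hw.inv
  -- The weight is undone by `w⁻¹`, as `w` is nowhere `0` or `∞`.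
  have hinv : (Q.withDensity (w ∘ f)).withDensity (w⁻¹ ∘ f) = Q :=
    withDensity_inv_same (hw.comp hf) (.of_forall fun a => h0 (f a))
      (.of_forall fun a => ht (f a))
  rw [hinv] at h2
  exact ⟨_, h2⟩

end IsFiberKernel

end FiberKernel

/-! ### The path space is Polish. -/

namespace MetricTree

variable {V : Type*} (T : MetricTree V) {n : ℕ}

lemma measurable_eval (p : T.Space) : Measurable fun ω : T.PathSpace n => ω p :=
  (continuous_eval_const p).measurable

lemma measurable_values {ι : Type*} (f : ι → V) : Measurable (T.values (n := n) f) :=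
  measurable_pi_lambda _ fun _ => T.measurable_eval _

variable [Finite V]

instance : Finite T.graph.Dart :=
  Finite.of_injective (fun d => d.toProd) fun _ _ h => SimpleGraph.Dart.ext _ _ h

instance : CompactSpace T.PreSpace :=
  letI : TopologicalSpace V := ⊥
  inferInstanceAs (CompactSpace (V ⊕ (Σ d : T.graph.Dart, Set.Icc (0 : ℝ) (T.len d.edge))))

instance : SecondCountableTopology T.PreSpace :=
  letI : TopologicalSpace V := ⊥
  haveI : DiscreteTopology V := ⟨rfl⟩
  inferInstanceAs (SecondCountableTopology
    (V ⊕ (Σ d : T.graph.Dart, Set.Icc (0 : ℝ) (T.len d.edge))))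

instance : T2Space T.PreSpace :=
  let _ : TopologicalSpace V := ⊥
  have : DiscreteTopology V := ⟨rfl⟩
  inferInstanceAs (T2Space
    (V ⊕ (Σ d : T.graph.Dart, Set.Icc (0 : ℝ) (T.len d.edge))))

instance : CompactSpace T.Space := inferInstanceAs (CompactSpace (Quot T.Glue))

/-- The quotient map onto the geometric realisation. -/
def quotMap : C(T.PreSpace, T.Space) := ⟨Quot.mk _, continuous_quot_mk⟩

/-- The quotient map is onto, so pulling back preserves the uniform distance. Separability of the
path space thus follows from that of paths on the unglued space. -/
lemma isometry_comp_quotMap :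
    Isometry fun ω : T.PathSpace n => ω.comp T.quotMap := by
  refine Isometry.of_dist_eq fun ω ω' => ?_
  rw [ContinuousMap.dist_eq_iSup, ContinuousMap.dist_eq_iSup]
  exact Function.Surjective.iSup_comp (f := T.quotMap) Quot.mk_surjective
    fun p => dist (ω p) (ω' p)

instance : SecondCountableTopology (T.PathSpace n) :=
  (T.isometry_comp_quotMap (n := n)).isEmbedding.secondCountableTopology

instance : PolishSpace (T.PathSpace n) := ⟨⟩

end MetricTree

/-! ### Correspondence of minimisers along a map, and its application to the tree. -/

section Reduction

variable {α β : Type*} {mα : MeasurableSpace α} {mβ : MeasurableSpace β} {f : α → β}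
  {Q : Measure α} [SigmaFinite (Q.map f)] {K : Kernel β α} {C : Set (Measure β)}
  {D : Set (Measure α)}

/-- Every competitor downstairs with entropy below `⊤` lifts to a feasible competitor upstairs with
equal entropy. -/
lemma isEntropyMinimizer_map (hf : Measurable f) (hCD : ∀ P, P ∈ D ↔ P.map f ∈ C) (hC : ∀ N ∈ C, IsProbabilityMeasure N)
    {P : Measure α} (h : IsEntropyMinimizer Q D P) : IsEntropyMinimizer (Q.map f) C (P.map f) := by
  obtain ⟨hD, htop, hbot, hmin⟩ := h
  have hPC := (hCD P).1 hD
  have := hC _ hPC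
  have : IsProbabilityMeasure P := (Measure.isProbabilityMeasure_map_iff hf.aemeasurable).1 this
  have key : ∀ N ∈ C, relEntropy P Q ≤ relEntropy N (Q.map f) := by
    intro N hN
    by_cases hNt : relEntropy N (Q.map f) = ⊤
    · rw [hNt]; exact le_top
    have hac := (relEntropy_ne_top_iff.1 hNt).1
    have := hC N hN
    rw [← relEntropy_liftAlong hf hac]
    refine hmin _ ((hCD _).2 ?_)
    rwa [map_liftAlong hf hac]
  have heq : relEntropy (P.map f) (Q.map f) = relEntropy P Q :=
    le_antisymm (relEntropy_map_le hf) (key _ hPC)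
  refine ⟨hPC, ?_, ?_, ?_⟩
  · rwa [heq]
  · rwa [heq]
  · rwa [heq]

lemma isEntropyMinimizer_bind (hf : Measurable f) (hCD : ∀ P, P ∈ D ↔ P.map f ∈ C)
    (hC : ∀ N ∈ C, IsProbabilityMeasure N) {N : Measure β} (hK : IsFiberKernel f Q K)
    (h : IsEntropyMinimizer (Q.map f) C N) : IsEntropyMinimizer Q D (N.bind K) := by
  obtain ⟨hN, htop, hbot, hmin⟩ := h
  have := hC _ hN
  have hac := (relEntropy_ne_top_iff.1 htop).1
  rw [hK.bind_eq_liftAlong hf hac]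
  refine ⟨(hCD _).2 ?_, ?_, ?_, fun P hP => ?_⟩
  · rwa [map_liftAlong hf hac]
  · rwa [relEntropy_liftAlong hf hac]
  · rwa [relEntropy_liftAlong hf hac]
  · rw [relEntropy_liftAlong hf hac]
    have hPC := (hCD P).1 hP
    have := hC _ hPC
    have : IsProbabilityMeasure P := (Measure.isProbabilityMeasure_map_iff hf.aemeasurable).1 this
    exact (hmin _ hPC).trans (relEntropy_map_le hf)

lemma IsEntropyMinimizer.unique_of_marginals {ι : Type*} {γ : Type*} [MeasurableSpace γ]
    {Q : Measure α} [SigmaFinite Q] {e : ι → α → γ} (he : ∀ i, Measurable (e i))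
    {μ : ι → Measure γ} {P P' : Measure α}
    (h : IsEntropyMinimizer Q {P | IsProbabilityMeasure P ∧ ∀ i, P.map (e i) = μ i} P)
    (h' : IsEntropyMinimizer Q {P | IsProbabilityMeasure P ∧ ∀ i, P.map (e i) = μ i} P') :
    P = P' := by
  refine h.unique (fun _ hP => hP.1) ?_ h'
  rintro P ⟨_, hP⟩ P' ⟨_, hP'⟩
  refine ⟨⟨?_⟩, fun i => ?_⟩
  · simp [ENNReal.inv_two_add_inv_two]
  · rw [Measure.map_add _ _ (he i), Measure.map_smul, Measure.map_smul, hP i, hP' i, ← add_smul,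
      ENNReal.inv_two_add_inv_two, one_smul]

end Reduction

namespace MetricTree

variable {V : Type*} (T : MetricTree V) {n : ℕ} {ι : Type*} {f : ι → V}

lemma sigmaFinite_of_jointLaw {Q : Measure (T.PathSpace n)} (h : SigmaFinite (T.jointLaw f Q)) :
    SigmaFinite Q :=
  SigmaFinite.of_map Q (T.measurable_values f).aemeasurable h

lemma mem_feasible_iff (S : Set V) (μ : S → Measure (EuclideanSpace ℝ (Fin n))) {g : S → ι}
    (hg : ∀ i, f (g i) = i) (P : Measure (T.PathSpace n)) :
    P ∈ {P : Measure (T.PathSpace n) |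
        IsProbabilityMeasure P ∧ ∀ i : S, P.map (fun ω => ω (T.vertex i)) = μ i} ↔
      P.map (T.values f) ∈ {R : Measure (ι → EuclideanSpace ℝ (Fin n)) |
        IsProbabilityMeasure R ∧ ∀ i : S, R.map (fun x => x (g i)) = μ i} := by
  have hf := T.measurable_values (n := n) f
  refine and_congr (Measure.isProbabilityMeasure_map_iff hf.aemeasurable).symm
    (forall_congr' fun i => ?_)
  rw [Measure.map_map (measurable_pi_apply _) hf]
  have : (fun x : ι → EuclideanSpace ℝ (Fin n) => x (g i)) ∘ T.values f
      = fun ω : T.PathSpace n => ω (T.vertex i) := by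
    funext ω
    simp [values, hg]
  rw [this]

end MetricTree

theorem schroedinger_reduction {V : Type*} [Finite V] (T : MetricTree V) {n : ℕ} (S : Set V)
    (μ : S → Measure (EuclideanSpace ℝ (Fin n)))
    (Q : Measure (T.PathSpace n)) (hQ : SigmaFinite (T.jointLaw (fun i : S => (i : V)) Q)) :
    (∀ P P', T.SolvesDynamic S μ Q P → T.SolvesDynamic S μ Q P' → P = P') ∧
      (∀ R R', T.SolvesStatic S μ Q R → T.SolvesStatic S μ Q R' → R = R') ∧
      (∀ R R', T.SolvesStaticOn S μ Q R → T.SolvesStaticOn S μ Q R' → R = R') ∧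
      (∀ P, T.SolvesDynamic S μ Q P → T.SolvesStatic S μ Q (T.jointLaw (fun v : V => v) P)) ∧
      (∃ K, T.IsBridgeKernel (fun v : V => v) Q K) ∧
      (∀ R K, T.SolvesStatic S μ Q R → T.IsBridgeKernel (fun v : V => v) Q K →
        T.SolvesDynamic S μ Q (R.bind K)) ∧
      (∀ P, T.SolvesDynamic S μ Q P →
        T.SolvesStaticOn S μ Q (T.jointLaw (fun i : S => (i : V)) P)) ∧
      (∃ K, T.IsBridgeKernel (fun i : S => (i : V)) Q K) ∧
      (∀ R K, T.SolvesStaticOn S μ Q R → T.IsBridgeKernel (fun i : S => (i : V)) Q K →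
        T.SolvesDynamic S μ Q (R.bind K)) := by
  have hQσ := T.sigmaFinite_of_jointLaw hQ
  have hfV := T.measurable_values (n := n) (fun v : V => v)
  have hfS := T.measurable_values (n := n) (fun i : S => (i : V))
  have hQV : SigmaFinite (Q.map (T.values fun v : V => v)) := by
    have hr : Measurable (S.domRestrict (π := fun _ => EuclideanSpace ℝ (Fin n))) :=
      measurable_pi_lambda _ fun i => measurable_pi_apply (i : V)
    -- The law at `S` is an image of the law at `V`, and σ-finiteness of an image passes back to the
    -- source.
    refine SigmaFinite.of_map _ hr.aemeasurable ?_
    rw [Measure.map_map hr hfV]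
    exact hQ
  have hQS : SigmaFinite (Q.map (T.values fun i : S => (i : V))) := hQ
  have hV := T.mem_feasible_iff S μ (f := fun v : V => v) (g := fun i => i) fun _ => rfl
  have hS := T.mem_feasible_iff S μ (f := fun i : S => (i : V)) (g := fun i => i) fun _ => rfl
  refine ⟨fun P P' h h' => h.unique_of_marginals (fun i => T.measurable_eval _) h',
    fun R R' h h' => ?_, fun R R' h h' => ?_,
    fun P h => isEntropyMinimizer_map hfV hV (fun _ h => h.1) h,
    IsFiberKernel.exists_of_sigmaFinite hfV,
    fun R K h hK => isEntropyMinimizer_bind hfV hV (fun _ h => h.1) hK h,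
    fun P h => isEntropyMinimizer_map hfS hS (fun _ h => h.1) h,
    IsFiberKernel.exists_of_sigmaFinite hfS,
    fun R K h hK => isEntropyMinimizer_bind hfS hS (fun _ h => h.1) hK h⟩
  · have : SigmaFinite (T.jointLaw (fun v : V => v) Q) := hQV
    exact IsEntropyMinimizer.unique_of_marginals (fun i : S => measurable_pi_apply (i : V)) h h'
  · exact IsEntropyMinimizer.unique_of_marginals (fun i : S => measurable_pi_apply i) h h'

/-! ### Linear interpolation along the edges and the bridge part of a path. -/

namespace MetricTree

variable {V : Type*} (T : MetricTree V) {n : ℕ}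

lemma len_edge_pos (d : T.graph.Dart) : 0 < T.len d.edge := T.len_pos _ d.edge_mem

/-- The endpoint of the interval of an oriented edge. -/
def lastTime (d : T.graph.Dart) : Set.Icc (0 : ℝ) (T.len d.edge) :=
  ⟨T.len d.edge, (T.len_edge_pos d).le, le_rfl⟩

/-- The time on the reversed edge. -/
def revTime (d : T.graph.Dart) (s : Set.Icc (0 : ℝ) (T.len d.edge)) :
    Set.Icc (0 : ℝ) (T.len d.symm.edge) :=
  ⟨T.len d.edge - s, sub_nonneg.2 s.2.2, by
    rw [SimpleGraph.Dart.edge_symm]; exact sub_le_self _ s.2.1⟩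

lemma edgePoint_symm_revTime (d : T.graph.Dart) (s : Set.Icc (0 : ℝ) (T.len d.edge)) :
    T.edgePoint d.symm (T.revTime d s) = T.edgePoint d s :=
  (Quot.sound (Glue.flip d s _ (by simp [revTime]))).symm

lemma edgePoint_lastTime (d : T.graph.Dart) : T.edgePoint d (T.lastTime d) = T.vertex d.snd := by
  rw [← edgePoint_symm_revTime]
  exact Quot.sound (Glue.start d.symm _ (by simp [revTime, lastTime]))

/-- An edge is oriented away from the root. -/
def Outward (r : V) (d : T.graph.Dart) : Prop := T.graph.dist r d.fst < T.graph.dist r d.snd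

/-- Adjacent vertices of a tree are at different distances from the root. The Brownian covariances
are prescribed only for outward orientations, so general edges are reduced to these. -/
lemma outward_or_outward_symm (r : V) (d : T.graph.Dart) :
    T.Outward r d ∨ T.Outward r d.symm :=
  lt_or_gt_of_ne (T.isTree.dist_ne_of_adj r d.adj)

lemma exists_outward (r : V) (p : T.Space) :
    (∃ v, p = T.vertex v) ∨ ∃ d s, T.Outward r d ∧ p = T.edgePoint d s := by
  induction p using Quot.ind with
  | mk a =>
    rcases a with v | ⟨d, s⟩
    · exact .inl ⟨v, rfl⟩
    · rcases T.outward_or_outward_symm r d with h | h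
      · exact .inr ⟨d, s, h, rfl⟩
      · exact .inr ⟨d.symm, T.revTime d s, h, (T.edgePoint_symm_revTime d s).symm⟩

/-- The piecewise linear function on the disjoint union of vertices and edges. -/
noncomputable def preInterp (x : V → EuclideanSpace ℝ (Fin n)) : T.PreSpace → EuclideanSpace ℝ (Fin n)
  | Sum.inl v => x v
  | Sum.inr ⟨d, t⟩ => x d.fst + ((t : ℝ) / T.len d.edge) • (x d.snd - x d.fst)

lemma preInterp_glue (x : V → EuclideanSpace ℝ (Fin n)) (a b : T.PreSpace) (h : T.Glue a b) :
    T.preInterp x a = T.preInterp x b := by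
  rcases h with ⟨d, t, ht⟩ | ⟨d, s, t, hst⟩
  · simp [preInterp, ht]
  · have hpos := T.len_edge_pos d
    have hl : T.len d.symm.edge = T.len d.edge := by rw [SimpleGraph.Dart.edge_symm]
    have ht : (t : ℝ) / T.len d.symm.edge = 1 - (s : ℝ) / T.len d.edge := by
      have hs : (s : ℝ) / T.len d.edge = s / T.len d.symm.edge := congrArg _ hl.symm
      rw [hs, eq_sub_iff_add_eq, ← add_div, add_comm, hst, hl, div_self hpos.ne']
    change x d.fst + ((s : ℝ) / T.len d.edge) • (x d.snd - x d.fst)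
      = x d.snd + ((t : ℝ) / T.len d.symm.edge) • (x d.fst - x d.snd)
    rw [ht]
    module

lemma continuous_preInterp (x : V → EuclideanSpace ℝ (Fin n)) : Continuous (T.preInterp x) := by
  let _ : TopologicalSpace V := ⊥
  have : DiscreteTopology V := ⟨rfl⟩
  refine continuous_sum_dom.2 ⟨continuous_of_discreteTopology, continuous_sigma fun d => ?_⟩
  change Continuous fun t : Set.Icc (0 : ℝ) (T.len d.edge) =>
    x d.fst + ((t : ℝ) / T.len d.edge) • (x d.snd - x d.fst)
  fun_prop

/-- The path that interpolates linearly along the edges between prescribed values at the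
vertices. -/
noncomputable def interpₗ : (V → EuclideanSpace ℝ (Fin n)) →ₗ[ℝ] T.PathSpace n where
  toFun x := ⟨Quot.lift (T.preInterp x) (T.preInterp_glue x),
    continuous_quot_lift _ (T.continuous_preInterp x)⟩
  map_add' x y := by
    ext1 p
    induction p using Quot.ind with
    | mk a =>
      rcases a with v | ⟨d, t⟩
      · rfl
      · change (x + y) d.fst + ((t : ℝ) / T.len d.edge) • ((x + y) d.snd - (x + y) d.fst)
          = (x d.fst + ((t : ℝ) / T.len d.edge) • (x d.snd - x d.fst))
            + (y d.fst + ((t : ℝ) / T.len d.edge) • (y d.snd - y d.fst))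
        simp only [Pi.add_apply]
        module
  map_smul' c x := by
    ext1 p
    induction p using Quot.ind with
    | mk a =>
      rcases a with v | ⟨d, t⟩
      · rfl
      · change (c • x) d.fst + ((t : ℝ) / T.len d.edge) • ((c • x) d.snd - (c • x) d.fst)
          = c • (x d.fst + ((t : ℝ) / T.len d.edge) • (x d.snd - x d.fst))
        simp only [Pi.smul_apply]
        module

variable [Finite V]

/-- Linear interpolation along the edges as a continuous linear map. -/
noncomputable def interp : (V → EuclideanSpace ℝ (Fin n)) →L[ℝ] T.PathSpace n :=
  ⟨T.interpₗ, LinearMap.continuous_of_finiteDimensional _⟩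

@[simp]
lemma interp_vertex (x : V → EuclideanSpace ℝ (Fin n)) (v : V) :
    T.interp x (T.vertex v) = x v := rfl

lemma interp_edgePoint (x : V → EuclideanSpace ℝ (Fin n)) (d : T.graph.Dart)
    (t : Set.Icc (0 : ℝ) (T.len d.edge)) : T.interp x (T.edgePoint d t)
      = x d.fst + ((t : ℝ) / T.len d.edge) • (x d.snd - x d.fst) := rfl

lemma interp_const (c : EuclideanSpace ℝ (Fin n)) :
    T.interp (fun _ => c) = ContinuousMap.const T.Space c := by
  ext1 p
  induction p using Quot.ind with
  | mk a =>
    rcases a with v | ⟨d, t⟩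
    · rfl
    · change c + ((t : ℝ) / T.len d.edge) • (c - c) = c
      simp

instance : TopologicalSpace.SeparableSpace T.Space :=
  inferInstanceAs (TopologicalSpace.SeparableSpace (Quot T.Glue))

/-- The difference between a path and the linear interpolation of its values at the vertices. -/
noncomputable def bridgePart (ω : T.PathSpace n) : T.PathSpace n := ω - T.interp (T.values (fun v => v) ω)

lemma interp_add_bridgePart (ω : T.PathSpace n) :
    T.interp (T.values (fun v => v) ω) + T.bridgePart ω = ω := by
  simp [bridgePart]

lemma measurable_bridgePart : Measurable (T.bridgePart (n := n)) :=
  measurable_id.sub (T.interp.continuous.measurable.comp (T.measurable_values _))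

lemma bridgePart_vertex (ω : T.PathSpace n) (v : V) : T.bridgePart ω (T.vertex v) = 0 := by
  simp [bridgePart, values]

/-- Only increments from the source of the edge appear, and these are the variables with prescribed
covariances. -/
lemma bridgePart_edgePoint (ω : T.PathSpace n) (d : T.graph.Dart)
    (t : Set.Icc (0 : ℝ) (T.len d.edge)) : T.bridgePart ω (T.edgePoint d t)
      = (ω (T.edgePoint d t) - ω (T.vertex d.fst))
        - ((t : ℝ) / T.len d.edge) • (ω (T.edgePoint d (T.lastTime d)) - ω (T.vertex d.fst)) := by
  rw [edgePoint_lastTime]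
  simp only [bridgePart, ContinuousMap.sub_apply, interp_edgePoint, values]
  abel

/-- Evaluation on a countable dense set is an injective measurable map out of a standard Borel
space, hence a measurable embedding; the path is a measurable function of its coordinates. -/
lemma indepFun_of_indepFun_eval {Ω γ : Type*} [MeasurableSpace Ω] [MeasurableSpace γ]
    {P : Measure Ω} {X : Ω → γ} {Y : Ω → T.PathSpace n}
    (h : IndepFun X (fun ω (p : T.Space × Fin n) => Y ω p.1 p.2) P) : IndepFun X Y P := by
  obtain ⟨D, hDc, hD⟩ := TopologicalSpace.exists_countable_dense T.Space
  have := hDc.to_subtype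
  let e : T.PathSpace n → (D × Fin n → ℝ) := fun ω p => ω p.1 p.2
  have he : MeasurableEmbedding e := by
    refine Measurable.measurableEmbedding ?_ fun ω ω' h => ?_
    · exact measurable_pi_lambda _ fun p =>
        (EuclideanSpace.proj p.2).continuous.measurable.comp (T.measurable_eval p.1)
    · refine DFunLike.coe_injective (Continuous.ext_on hD ω.continuous ω'.continuous ?_)
      intro p hp
      ext i
      exact congrFun h (⟨p, hp⟩, i)
  have hφ : Measurable fun (g : T.Space × Fin n → ℝ) (p : D × Fin n) => g (p.1, p.2) :=
    measurable_pi_lambda _ fun p => measurable_pi_apply _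
  have h2 := h.comp measurable_id (he.measurable_invFun.comp hφ)
  have hY : (he.invFun ∘ fun (g : T.Space × Fin n → ℝ) (p : D × Fin n) => g (p.1, p.2)) ∘
      (fun ω (p : T.Space × Fin n) => Y ω p.1 p.2) = Y := by
    funext ω
    exact he.leftInverse_invFun (Y ω)
  rwa [hY] at h2

end MetricTree

/-! ### Gaussian processes, and independence of vertex values and bridge part. -/

section Gaussian

lemma ProbabilityTheory.IsGaussianProcess.const_add {Ω E I : Type*} [MeasurableSpace Ω]
    [NormedAddCommGroup E] [NormedSpace ℝ E] [MeasurableSpace E] [BorelSpace E]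
    [SecondCountableTopology E] {P : Measure Ω} {X : I → Ω → E} (hX : IsGaussianProcess X P)
    (c : I → E) : IsGaussianProcess (fun i ω => c i + X i ω) P where
  hasGaussianLaw J := by
    have h := hX.hasGaussianLaw J
    have := h.isGaussian_map
    refine ⟨?_⟩
    have e : (fun ω => J.restrict fun i => c i + X i ω)
        = (fun x => J.restrict c + x) ∘ fun ω => J.restrict fun i => X i ω := rfl
    rw [e, ← AEMeasurable.map_map_of_aemeasurable (by fun_prop) h.aemeasurable]
    infer_instance

lemma ProbabilityTheory.IsGaussianProcess.map {Ω Ω' E I : Type*} [MeasurableSpace Ω]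
    [MeasurableSpace Ω'] [MeasurableSpace E] [TopologicalSpace E] [AddCommMonoid E] [Module ℝ E]
    {P : Measure Ω} {g : Ω → Ω'} (hg : Measurable g) {X : I → Ω' → E}
    (hmX : ∀ i, Measurable (X i)) (hX : IsGaussianProcess (fun i ω => X i (g ω)) P) :
    IsGaussianProcess X (P.map g) where
  hasGaussianLaw J := by
    have h := (hX.hasGaussianLaw J).isGaussian_map
    refine ⟨?_⟩
    have hm : Measurable fun ω => J.restrict fun i => X i ω :=
      measurable_pi_lambda _ fun i => hmX i
    rw [Measure.map_map hm hg]
    exact h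

end Gaussian

namespace MetricTree

variable {V : Type*} {T : MetricTree V} {n : ℕ}

namespace IsTreeBrownianFromZero

variable {r : V} {σ : ℝ} {W : Measure (T.PathSpace n)}

lemma memLp_eval (hW : T.IsTreeBrownianFromZero r σ W) (p : T.Space) (i : Fin n) :
    MemLp (fun ω : T.PathSpace n => ω p i) 2 W :=
  ((hW.gaussian.hasGaussianLaw_eval p).map_fun (EuclideanSpace.proj i)).memLp_two

lemma integrable_eval (hW : T.IsTreeBrownianFromZero r σ W) (p : T.Space) :
    Integrable (fun ω : T.PathSpace n => ω p) W :=
  (hW.gaussian.hasGaussianLaw_eval p).integrable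

lemma memLp_increment (hW : T.IsTreeBrownianFromZero r σ W) (p q : T.Space) (i : Fin n) :
    MemLp (fun ω : T.PathSpace n => (ω p - ω q) i) 2 W :=
  (hW.memLp_eval p i).sub (hW.memLp_eval q i)

end IsTreeBrownianFromZero

variable [Finite V]

/-- Each new variable is a linear function of finitely many path values. This makes the vertex
values and the bridge part jointly Gaussian. -/
lemma isGaussianProcess_of_values {W : Measure (T.PathSpace n)} {F I : Type*}
    [NormedAddCommGroup F] [NormedSpace ℝ F] [MeasurableSpace F] [BorelSpace F]
    [SecondCountableTopology F]
    (hW : IsGaussianProcess (fun (p : T.Space) (ω : T.PathSpace n) => ω p) W) (p : I → T.Space)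
    (L : I → (EuclideanSpace ℝ (Fin n) × (V → EuclideanSpace ℝ (Fin n))) →L[ℝ] F) :
    IsGaussianProcess
      (fun i (ω : T.PathSpace n) => L i (ω (p i), T.values (fun v => v) ω)) W := by
  classical
  have := Fintype.ofFinite V
  refine hW.of_isGaussianProcess fun i => ?_
  refine ⟨insert (p i) (Finset.univ.image T.vertex), (L i).comp
    ((ContinuousLinearMap.proj ⟨p i, by simp⟩).prod
      (ContinuousLinearMap.pi fun v => ContinuousLinearMap.proj ⟨T.vertex v, by simp⟩)),
    fun ω => ?_⟩
  rfl

/-- The bridge part of a path at a point as a function of the value at this point and of the values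
at the vertices. -/
noncomputable def bridgeMap (T : MetricTree V) (n : ℕ) (p : T.Space) :
    (EuclideanSpace ℝ (Fin n) × (V → EuclideanSpace ℝ (Fin n))) →L[ℝ] EuclideanSpace ℝ (Fin n) :=
  ContinuousLinearMap.fst _ _ _ -
    ((ContinuousMap.evalCLM ℝ p).comp T.interp).comp (ContinuousLinearMap.snd _ _ _)

namespace IsTreeBrownianFromZero

variable {r : V} {σ : ℝ} {W : Measure (T.PathSpace n)}

lemma isGaussianProcess_bridgePart (hW : T.IsTreeBrownianFromZero r σ W) :
    IsGaussianProcess (fun (p : T.Space) (ω : T.PathSpace n) => T.bridgePart ω p) W :=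
  isGaussianProcess_of_values hW.gaussian id (T.bridgeMap n)

lemma memLp_bridgePart (hW : T.IsTreeBrownianFromZero r σ W) (p : T.Space) (i : Fin n) :
    MemLp (fun ω : T.PathSpace n => T.bridgePart ω p i) 2 W :=
  ((hW.isGaussianProcess_bridgePart.hasGaussianLaw_eval p).map_fun
    (EuclideanSpace.proj i)).memLp_two

lemma bridgePart_edgePoint_apply (ω : T.PathSpace n) (d : T.graph.Dart)
    (s : Set.Icc (0 : ℝ) (T.len d.edge)) (i : Fin n) : T.bridgePart ω (T.edgePoint d s) i
      = (ω (T.edgePoint d s) - ω (T.vertex d.fst)) i - ((s : ℝ) / T.len d.edge) *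
        (ω (T.edgePoint d (T.lastTime d)) - ω (T.vertex d.fst)) i := by
  rw [bridgePart_edgePoint]
  rfl

lemma covariance_increment_bridgePart (hW : T.IsTreeBrownianFromZero r σ W)
    {d : T.graph.Dart} (hd : T.Outward r d) (s t : Set.Icc (0 : ℝ) (T.len d.edge))
    (i j : Fin n) :
    covariance (fun ω : T.PathSpace n => (ω (T.edgePoint d t) - ω (T.vertex d.fst)) j)
      (fun ω => T.bridgePart ω (T.edgePoint d s) i) W
      = if i = j then σ ^ 2 * (min (s : ℝ) t - s * t / T.len d.edge) else 0 := by
  have := hW.isProbabilityMeasure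
  have hpos := T.len_edge_pos d
  simp_rw [bridgePart_edgePoint_apply]
  rw [covariance_fun_sub_right (hW.memLp_increment _ _ _) (hW.memLp_increment _ _ _)
    ((hW.memLp_increment _ _ _).const_mul _), covariance_const_mul_right,
    hW.cov_same d hd, hW.cov_same d hd]
  have hmin : min (t : ℝ) (T.lastTime d : ℝ) = t := min_eq_left t.2.2
  rw [hmin]
  by_cases hij : j = i
  · simp only [hij, if_true]
    rw [min_comm]
    field_simp
  · simp [hij, Ne.symm hij]

lemma covariance_increment_bridgePart_of_ne (hW : T.IsTreeBrownianFromZero r σ W)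
    {d d' : T.graph.Dart} (hd : T.Outward r d) (hd' : T.Outward r d') (h : d' ≠ d)
    (s : Set.Icc (0 : ℝ) (T.len d.edge)) (t : Set.Icc (0 : ℝ) (T.len d'.edge)) (i j : Fin n) :
    covariance (fun ω : T.PathSpace n => (ω (T.edgePoint d' t) - ω (T.vertex d'.fst)) j)
      (fun ω => T.bridgePart ω (T.edgePoint d s) i) W = 0 := by
  have := hW.isProbabilityMeasure
  simp_rw [bridgePart_edgePoint_apply]
  rw [covariance_fun_sub_right (hW.memLp_increment _ _ _) (hW.memLp_increment _ _ _)
    ((hW.memLp_increment _ _ _).const_mul _), covariance_const_mul_right,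
    hW.cov_ne d' d hd' hd h, hW.cov_ne d' d hd' hd h]
  simp

/-- The crucial cancellation: over the full edge of length `ℓ`, the covariance is proportional to
`min s ℓ - s * ℓ / ℓ = 0`. -/
lemma covariance_lastIncrement_bridgePart (hW : T.IsTreeBrownianFromZero r σ W)
    {d : T.graph.Dart} (hd : T.Outward r d) (p : T.Space) (i j : Fin n) :
    covariance (fun ω : T.PathSpace n => (ω (T.vertex d.snd) - ω (T.vertex d.fst)) j)
      (fun ω => T.bridgePart ω p i) W = 0 := by
  have := hW.isProbabilityMeasure
  rcases T.exists_outward r p with ⟨v, rfl⟩ | ⟨d', s, hd', rfl⟩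
  · simp only [bridgePart_vertex, PiLp.zero_apply]
    exact covariance_const_right 0
  · rw [← edgePoint_lastTime]
    by_cases h : d = d'
    · subst h
      rw [hW.covariance_increment_bridgePart hd]
      have hmin : min (s : ℝ) (T.lastTime d : ℝ) = s := min_eq_left s.2.2
      have hl : (T.lastTime d : ℝ) = T.len d.edge := rfl
      rw [hmin, hl, mul_div_cancel_right₀ _ (T.len_edge_pos d).ne']
      simp
    · exact hW.covariance_increment_bridgePart_of_ne hd' hd h _ _ _ _

lemma covariance_vertex_bridgePart (hW : T.IsTreeBrownianFromZero r σ W) (v : V) (p : T.Space)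
    (i j : Fin n) :
    covariance (fun ω : T.PathSpace n => ω (T.vertex v) j)
      (fun ω => T.bridgePart ω p i) W = 0 := by
  have := hW.isProbabilityMeasure
  -- Induction along a walk from the root, where the value is `0`: crossing an edge adds or removes
  -- a full increment, which is uncorrelated with the bridge part.
  have hreach := (T.graph.reachable_iff_reflTransGen r v).1 (T.isTree.connected r v)
  induction hreach with
  | refl =>
    have h0 : (fun ω : T.PathSpace n => ω (T.vertex r) j) =ᵐ[W] fun _ => (0 : ℝ) := by
      filter_upwards [hW.root] with ω hω
      simp [hω]
    refine integral_eq_zero_of_ae ?_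
    filter_upwards [h0] with ω hω
    simp [hω, integral_congr_ae h0]
  | @tail u w _ huw ih =>
    have key : ∀ d : T.graph.Dart, T.Outward r d →
        covariance (fun ω : T.PathSpace n => ω (T.vertex d.snd) j)
          (fun ω => T.bridgePart ω p i) W
        = covariance (fun ω : T.PathSpace n => ω (T.vertex d.fst) j)
          (fun ω => T.bridgePart ω p i) W := by
      intro d hd
      have h := hW.covariance_lastIncrement_bridgePart hd p i j
      simp only [PiLp.sub_apply] at h
      rw [covariance_fun_sub_left (hW.memLp_eval _ _) (hW.memLp_eval _ _)
        (hW.memLp_bridgePart _ _)] at h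
      linarith
    rcases T.outward_or_outward_symm r ⟨(u, w), huw⟩ with h | h
    · rw [← ih]; exact key _ h
    · rw [← ih]; exact (key _ h).symm

lemma indepFun_values_bridgePart (hW : T.IsTreeBrownianFromZero r σ W) :
    IndepFun (T.values fun v => v) T.bridgePart W := by
  refine T.indepFun_of_indepFun_eval ?_
  let X : V × Fin n → T.PathSpace n → ℝ := fun q ω => ω (T.vertex q.1) q.2
  let Y : T.Space × Fin n → T.PathSpace n → ℝ := fun q ω => T.bridgePart ω q.1 q.2
  have hXm : ∀ q, Measurable (X q) := fun q =>
    (EuclideanSpace.proj q.2).continuous.measurable.comp (T.measurable_eval _)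
  have hYm : ∀ q, Measurable (Y q) := fun q =>
    (EuclideanSpace.proj q.2).continuous.measurable.comp
      ((T.measurable_eval _).comp T.measurable_bridgePart)
  have hXY : IsGaussianProcess (Sum.elim X Y) W := by
    have h := isGaussianProcess_of_values (I := (V × Fin n) ⊕ (T.Space × Fin n)) hW.gaussian
      (Sum.elim (fun q => T.vertex q.1) fun q => q.1)
      (Sum.elim
        (fun q => (EuclideanSpace.proj q.2 : EuclideanSpace ℝ (Fin n) →L[ℝ] ℝ).comp
          (ContinuousLinearMap.fst _ _ _))
        (fun q => (EuclideanSpace.proj q.2 : EuclideanSpace ℝ (Fin n) →L[ℝ] ℝ).comp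
          (T.bridgeMap n q.1)))
    refine h.congr fun q => .of_forall fun ω => ?_
    rcases q with q | q <;> rfl
  have hind := hXY.indepFun_of_covariance_eq_zero (fun q => (hXm q).aemeasurable)
    (fun q => (hYm q).aemeasurable)
    fun q q' => hW.covariance_vertex_bridgePart q.1 q'.1 q'.2 q.2
  have hφ : Measurable fun (g : V × Fin n → ℝ) (v : V) =>
      WithLp.toLp 2 fun i => g (v, i) :=
    measurable_pi_lambda _ fun v => (WithLp.measurable_toLp 2 _).comp
      (measurable_pi_lambda _ fun i => measurable_pi_apply _)
  exact hind.comp hφ measurable_id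

end IsTreeBrownianFromZero

end MetricTree

/-! ### Covariance of the bridge part, and the bridge kernel of the Brownian reference. -/

namespace MetricTree

variable {V : Type*} {T : MetricTree V} {n : ℕ}

section Covariance

variable [Finite V] {r : V} {σ : ℝ} {W : Measure (T.PathSpace n)}

namespace IsTreeBrownianFromZero

lemma covariance_bridgePart_of_outward (hW : T.IsTreeBrownianFromZero r σ W)
    {d : T.graph.Dart} (hd : T.Outward r d) (s t : Set.Icc (0 : ℝ) (T.len d.edge))
    (i j : Fin n) :
    covariance (fun ω : T.PathSpace n => T.bridgePart ω (T.edgePoint d s) i)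
      (fun ω => T.bridgePart ω (T.edgePoint d t) j) W
      = if i = j then σ ^ 2 * (min (s : ℝ) t - s * t / T.len d.edge) else 0 := by
  have := hW.isProbabilityMeasure
  -- Only the left factor is expanded: its full-edge increment is uncorrelated with the right factor
  -- and drops out.
  have h0 : (fun ω : T.PathSpace n => T.bridgePart ω (T.edgePoint d s) i) = fun ω =>
      (ω (T.edgePoint d s) - ω (T.vertex d.fst)) i - ((s : ℝ) / T.len d.edge) *
        (ω (T.vertex d.snd) - ω (T.vertex d.fst)) i := by
    funext ω
    rw [bridgePart_edgePoint_apply, edgePoint_lastTime]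
  rw [h0, covariance_fun_sub_left (hW.memLp_increment _ _ _)
    ((hW.memLp_increment _ _ _).const_mul _) (hW.memLp_bridgePart _ _),
    covariance_const_mul_left, hW.covariance_lastIncrement_bridgePart hd,
    hW.covariance_increment_bridgePart hd, mul_zero, sub_zero, min_comm, mul_comm (t : ℝ)]
  simp only [eq_comm]

lemma covariance_bridgePart_of_outward_of_ne (hW : T.IsTreeBrownianFromZero r σ W)
    {d d' : T.graph.Dart} (hd : T.Outward r d) (hd' : T.Outward r d') (h : d ≠ d')
    (s : Set.Icc (0 : ℝ) (T.len d.edge)) (t : Set.Icc (0 : ℝ) (T.len d'.edge)) (i j : Fin n) :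
    covariance (fun ω : T.PathSpace n => T.bridgePart ω (T.edgePoint d s) i)
      (fun ω => T.bridgePart ω (T.edgePoint d' t) j) W = 0 := by
  have := hW.isProbabilityMeasure
  simp_rw [bridgePart_edgePoint_apply (d := d)]
  rw [covariance_fun_sub_left (hW.memLp_increment _ _ _)
    ((hW.memLp_increment _ _ _).const_mul _) (hW.memLp_bridgePart _ _),
    covariance_const_mul_left, hW.covariance_increment_bridgePart_of_ne hd' hd h,
    hW.covariance_increment_bridgePart_of_ne hd' hd h]
  simp

lemma covariance_bridgePart (hW : T.IsTreeBrownianFromZero r σ W)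
    (d : T.graph.Dart) (s t : Set.Icc (0 : ℝ) (T.len d.edge)) (hst : s ≤ t) (i j : Fin n) :
    covariance (fun ω : T.PathSpace n => T.bridgePart ω (T.edgePoint d s) i)
      (fun ω => T.bridgePart ω (T.edgePoint d t) j) W
      = if i = j then σ ^ 2 * (s * (T.len d.edge - t) / T.len d.edge) else 0 := by
  have hst' : (s : ℝ) ≤ t := hst
  have hpos := T.len_edge_pos d
  rcases T.outward_or_outward_symm r d with hd | hd
  · rw [hW.covariance_bridgePart_of_outward hd, min_eq_left hst']
    congr 2
    field_simp
  -- An inward edge is read backwards; the bridge covariance is invariant under time reversal.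
  · rw [← T.edgePoint_symm_revTime d s, ← T.edgePoint_symm_revTime d t,
      hW.covariance_bridgePart_of_outward hd]
    have hl : T.len d.symm.edge = T.len d.edge := by rw [SimpleGraph.Dart.edge_symm]
    have hs : ((T.revTime d s : ℝ)) = T.len d.edge - s := rfl
    have ht : ((T.revTime d t : ℝ)) = T.len d.edge - t := rfl
    rw [hs, ht, hl, min_eq_right (sub_le_sub_left hst' _)]
    congr 2
    field_simp
    ring

lemma covariance_bridgePart_of_ne (hW : T.IsTreeBrownianFromZero r σ W)
    {d d' : T.graph.Dart} (h : d.edge ≠ d'.edge)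
    (s : Set.Icc (0 : ℝ) (T.len d.edge)) (t : Set.Icc (0 : ℝ) (T.len d'.edge)) (i j : Fin n) :
    covariance (fun ω : T.PathSpace n => T.bridgePart ω (T.edgePoint d s) i)
      (fun ω => T.bridgePart ω (T.edgePoint d' t) j) W = 0 := by
  rcases T.outward_or_outward_symm r d with hd | hd <;>
    rcases T.outward_or_outward_symm r d' with hd' | hd'
  · exact hW.covariance_bridgePart_of_outward_of_ne hd hd' (fun e => h (by rw [e])) _ _ _ _
  · rw [← T.edgePoint_symm_revTime d']
    refine hW.covariance_bridgePart_of_outward_of_ne hd hd' (fun e => h ?_) _ _ _ _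
    rw [e, SimpleGraph.Dart.edge_symm]
  · rw [← T.edgePoint_symm_revTime d]
    refine hW.covariance_bridgePart_of_outward_of_ne hd hd' (fun e => h ?_) _ _ _ _
    rw [← e, SimpleGraph.Dart.edge_symm]
  · rw [← T.edgePoint_symm_revTime d, ← T.edgePoint_symm_revTime d']
    refine hW.covariance_bridgePart_of_outward_of_ne hd hd' (fun e => h ?_) _ _ _ _
    rw [← SimpleGraph.Dart.edge_symm, e, SimpleGraph.Dart.edge_symm]

lemma integral_bridgePart (hW : T.IsTreeBrownianFromZero r σ W) (d : T.graph.Dart)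
    (t : Set.Icc (0 : ℝ) (T.len d.edge)) :
    ∫ ω, T.bridgePart ω (T.edgePoint d t) ∂W = 0 := by
  simp_rw [bridgePart_edgePoint]
  have hi : ∀ p q : T.Space, Integrable (fun ω : T.PathSpace n => ω p - ω q) W := fun p q =>
    (hW.integrable_eval p).sub (hW.integrable_eval q)
  have h0 : ∀ p q : T.Space, ∫ ω : T.PathSpace n, (ω p - ω q) ∂W = 0 := fun p q => by
    rw [integral_sub (hW.integrable_eval p) (hW.integrable_eval q), hW.mean, hW.mean, sub_zero]
  rw [integral_sub (hi _ _) ((hi _ _).fun_smul _), integral_smul, h0, h0, smul_zero, sub_zero]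

/-- Interpolating prescribed values at the vertices and adding the bridge part of a tree-indexed
Brownian motion gives independent Brownian bridges along the edges. -/
lemma isEdgewiseBrownianBridge_map (hW : T.IsTreeBrownianFromZero r σ W)
    (x : V → EuclideanSpace ℝ (Fin n)) :
    T.IsEdgewiseBrownianBridge σ x (W.map fun ω => T.interp x + T.bridgePart ω) := by
  have := hW.isProbabilityMeasure
  have hg : Measurable fun ω : T.PathSpace n => T.interp x + T.bridgePart ω :=
    T.measurable_bridgePart.const_add _
  have hev : ∀ (p : T.Space) (i : Fin n), Measurable fun ω : T.PathSpace n => ω p i := fun p i =>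
    (EuclideanSpace.proj i).continuous.measurable.comp (T.measurable_eval p)
  have hcov : ∀ (p q : T.Space) (i j : Fin n),
      covariance (fun ω : T.PathSpace n => ω p i) (fun ω => ω q j)
        (W.map fun ω => T.interp x + T.bridgePart ω)
      = covariance (fun ω : T.PathSpace n => T.bridgePart ω p i)
        (fun ω => T.bridgePart ω q j) W := by
    intro p q i j
    rw [covariance_map_fun (hev p i).aestronglyMeasurable (hev q j).aestronglyMeasurable
      hg.aemeasurable]
    simp only [ContinuousMap.add_apply, PiLp.add_apply]
    rw [covariance_const_add_left ((hW.memLp_bridgePart _ _).integrable (by norm_num)),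
      covariance_const_add_right ((hW.memLp_bridgePart _ _).integrable (by norm_num))]
  refine ⟨Measure.isProbabilityMeasure_map hg.aemeasurable, fun v => ?_, ?_, fun d t => ?_,
    fun d s t hst i j => ?_, fun d d' h s t i j => ?_⟩
  · rw [ae_map_iff (p := fun ω => ω (T.vertex v) = x v) hg.aemeasurable
      (T.measurable_eval _ (measurableSet_singleton (x v)))]
    refine .of_forall fun ω => ?_
    simp [bridgePart_vertex]
  · exact .map hg T.measurable_eval
      (hW.isGaussianProcess_bridgePart.const_add fun p => T.interp x p)
  · rw [integral_map hg.aemeasurable (T.measurable_eval _).aestronglyMeasurable]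
    simp only [ContinuousMap.add_apply]
    rw [integral_add (integrable_const _)
      (hW.isGaussianProcess_bridgePart.hasGaussianLaw_eval _).integrable,
      hW.integral_bridgePart, interp_edgePoint]
    simp
  · rw [hcov, hW.covariance_bridgePart d s t hst]
  · rw [hcov, hW.covariance_bridgePart_of_ne h]

end IsTreeBrownianFromZero

end Covariance

lemma sigmaFinite_jointLaw_of_map {ι : Type*} {f : ι → V} {Q : Measure (T.PathSpace n)} (i : ι)
    (h : SigmaFinite (Q.map fun ω => ω (T.vertex (f i)))) : SigmaFinite (T.jointLaw f Q) := by
  refine SigmaFinite.of_map _ (measurable_pi_apply i).aemeasurable ?_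
  rw [jointLaw, Measure.map_map (measurable_pi_apply i) (T.measurable_values f)]
  exact h

variable [Finite V] {r : V} {σ : ℝ} {W : Measure (T.PathSpace n)}
  {m : Measure (EuclideanSpace ℝ (Fin n))}

lemma measurable_const_add :
    Measurable fun p : EuclideanSpace ℝ (Fin n) × T.PathSpace n =>
      ContinuousMap.const T.Space p.1 + p.2 := by
  have : Continuous fun c : EuclideanSpace ℝ (Fin n) => ContinuousMap.const T.Space c :=
    ContinuousMap.continuous_const'
  exact (this.measurable.comp measurable_fst).add measurable_snd

namespace IsTreeBrownianFromZero

lemma map_vertex_root (hW : T.IsTreeBrownianFromZero r σ W) [SigmaFinite m] :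
    ((m.prod W).map fun p => ContinuousMap.const T.Space p.1 + p.2).map
      (fun ω => ω (T.vertex r)) = m := by
  have := hW.isProbabilityMeasure
  rw [Measure.map_map (T.measurable_eval _) measurable_const_add]
  have h : (fun ω : T.PathSpace n => ω (T.vertex r)) ∘
      (fun p : EuclideanSpace ℝ (Fin n) × T.PathSpace n =>
        ContinuousMap.const T.Space p.1 + p.2) =ᵐ[m.prod W] Prod.fst := by
    have h0 : ∀ᵐ p ∂(m.prod W), p.2 (T.vertex r) = 0 :=
      Measure.quasiMeasurePreserving_snd.ae hW.root
    filter_upwards [h0] with p hp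
    simp [hp]
  rw [Measure.map_congr h, Measure.map_fst_prod]
  simp

/-- For each fixed path of `W`, the start is translated by a fixed vector, which preserves Lebesgue
measure. -/
lemma map_vertex_volume (hW : T.IsTreeBrownianFromZero r σ W) (v : V) :
    ((volume.prod W).map fun p => ContinuousMap.const T.Space p.1 + p.2).map
      (fun ω => ω (T.vertex v)) = (volume : Measure (EuclideanSpace ℝ (Fin n))) := by
  have := hW.isProbabilityMeasure
  rw [Measure.map_map (T.measurable_eval _) measurable_const_add]
  have hm : Measurable ((fun ω : T.PathSpace n => ω (T.vertex v)) ∘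
      (fun p : EuclideanSpace ℝ (Fin n) × T.PathSpace n =>
        ContinuousMap.const T.Space p.1 + p.2)) :=
    (T.measurable_eval _).comp measurable_const_add
  ext s hs
  rw [Measure.map_apply hm hs, Measure.prod_apply_symm (hm hs)]
  have : ∀ ω : T.PathSpace n, volume ((fun c : EuclideanSpace ℝ (Fin n) => (c, ω)) ⁻¹'
      (((fun ω : T.PathSpace n => ω (T.vertex v)) ∘
        (fun p : EuclideanSpace ℝ (Fin n) × T.PathSpace n =>
          ContinuousMap.const T.Space p.1 + p.2)) ⁻¹' s)) = volume s := fun ω =>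
    measure_preimage_add_right volume (ω (T.vertex v)) s
  simp [this]

/-- The kernel of laws of independent Brownian bridges along the edges. -/
noncomputable def bridgeKernel (W : Measure (T.PathSpace n)) :
    Kernel (V → EuclideanSpace ℝ (Fin n)) (T.PathSpace n) :=
  (Kernel.id ×ₖ Kernel.const _ (W.map T.bridgePart)).map fun p => T.interp p.1 + p.2

lemma measurable_interp_add :
    Measurable fun p : (V → EuclideanSpace ℝ (Fin n)) × T.PathSpace n => T.interp p.1 + p.2 :=
  (T.interp.continuous.measurable.comp measurable_fst).add measurable_snd

lemma bridgeKernel_apply [IsProbabilityMeasure W] (x : V → EuclideanSpace ℝ (Fin n)) :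
    bridgeKernel W x = W.map fun ω => T.interp x + T.bridgePart ω := by
  have := Measure.isProbabilityMeasure_map (μ := W) T.measurable_bridgePart.aemeasurable
  rw [bridgeKernel, Kernel.map_apply _ measurable_interp_add, Kernel.prod_apply, Kernel.id_apply,
    Kernel.const_apply, Measure.dirac_prod, Measure.map_map measurable_interp_add
      measurable_prodMk_left, Measure.map_map (measurable_interp_add.comp measurable_prodMk_left)
      T.measurable_bridgePart]
  rfl

lemma bind_bridgeKernel [IsProbabilityMeasure W]
    (N : Measure (V → EuclideanSpace ℝ (Fin n))) [SFinite N] :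
    N.bind (bridgeKernel W)
      = (N.prod (W.map T.bridgePart)).map fun p => T.interp p.1 + p.2 := by
  have := Measure.isProbabilityMeasure_map (μ := W) T.measurable_bridgePart.aemeasurable
  ext s hs
  rw [Measure.bind_apply hs (Kernel.aemeasurable _), Measure.map_apply measurable_interp_add hs,
    Measure.prod_apply (measurable_interp_add hs)]
  refine lintegral_congr fun x => ?_
  have hx : Measurable fun ω : T.PathSpace n => T.interp x + T.bridgePart ω :=
    T.measurable_bridgePart.const_add _
  rw [bridgeKernel_apply, Measure.map_apply hx hs, Measure.map_apply T.measurable_bridgePart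
    (measurable_prodMk_left (measurable_interp_add hs))]
  rfl

lemma isBridgeKernel (hW : T.IsTreeBrownianFromZero r σ W) [SigmaFinite m] :
    T.IsBridgeKernel (fun v : V => v)
      ((m.prod W).map fun p => ContinuousMap.const T.Space p.1 + p.2) (bridgeKernel W) := by
  have := hW.isProbabilityMeasure
  have hB := Measure.isProbabilityMeasure_map (μ := W) T.measurable_bridgePart.aemeasurable
  have hval := T.measurable_values (n := n) (fun v : V => v)
  have hVp := Measure.isProbabilityMeasure_map (μ := W) hval.aemeasurable
  refine ⟨⟨fun x => ?_⟩, ?_, .of_forall fun x => ?_⟩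
  · rw [bridgeKernel_apply]
    exact (hW.isEdgewiseBrownianBridge_map x).isProbabilityMeasure
  · let g : EuclideanSpace ℝ (Fin n) × (V → EuclideanSpace ℝ (Fin n)) →
        (V → EuclideanSpace ℝ (Fin n)) := fun p v => p.1 + p.2 v
    have hg : Measurable g := by fun_prop
    have hjoint : T.jointLaw (fun v : V => v)
        ((m.prod W).map fun p => ContinuousMap.const T.Space p.1 + p.2)
        = (m.prod (W.map (T.values fun v => v))).map g := by
      have h1 := Measure.map_prod_map m W measurable_id hval
      rw [Measure.map_id] at h1
      rw [jointLaw, Measure.map_map hval measurable_const_add, h1,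
        Measure.map_map hg (measurable_id.prodMap hval)]
      rfl
    have hind := (indepFun_iff_map_prod_eq_prod_map_map hval.aemeasurable
      T.measurable_bridgePart.aemeasurable).1 hW.indepFun_values_bridgePart
    rw [hjoint, bind_bridgeKernel]
    have h2 := Measure.map_prod_map (m.prod (W.map (T.values fun v => v))) (W.map T.bridgePart)
      hg measurable_id
    rw [Measure.map_id] at h2
    -- Under `m.prod W`, the start, the vertex values and the bridge part are independent;
    -- reassociating groups the first two, which together determine the shifted vertex values.
    have h3 := Measure.map_prod_map m W measurable_id (hval.prodMk T.measurable_bridgePart)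
    rw [Measure.map_id, hind, ← Measure.prodAssoc_prod] at h3
    have h4 := congrArg (Measure.map MeasurableEquiv.prodAssoc.symm) h3
    rw [Measure.map_map (MeasurableEquiv.measurable _) (MeasurableEquiv.measurable _),
      MeasurableEquiv.symm_comp_self, Measure.map_id,
      Measure.map_map (MeasurableEquiv.measurable _)
        (measurable_id.prodMap (hval.prodMk T.measurable_bridgePart))] at h4
    have h5 : Measurable (MeasurableEquiv.prodAssoc.symm ∘ Prod.map id
        fun ω : T.PathSpace n => (T.values (fun v => v) ω, T.bridgePart ω) :
        EuclideanSpace ℝ (Fin n) × T.PathSpace n → _) :=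
      (MeasurableEquiv.measurable _).comp
        (measurable_id.prodMap (hval.prodMk T.measurable_bridgePart))
    rw [h2, h4, Measure.map_map (hg.prodMap measurable_id) h5,
      Measure.map_map measurable_interp_add ((hg.prodMap measurable_id).comp h5)]
    congr 1
    funext p
    change T.interp (fun v => p.1 + T.values (fun v => v) p.2 v) + T.bridgePart p.2 = _
    have : (fun v => p.1 + T.values (fun v => v) p.2 v)
        = (fun _ => p.1) + T.values (fun v => v) p.2 := rfl
    -- Interpolation reproduces constants, so shifting the vertex values by the start shifts the
    -- whole path by it.
    rw [this, map_add, add_assoc, interp_add_bridgePart, interp_const]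
  · rw [bridgeKernel_apply]
    have hx : Measurable fun ω : T.PathSpace n => T.interp x + T.bridgePart ω :=
      T.measurable_bridgePart.const_add _
    rw [ae_map_iff (p := fun ω => T.values (fun v => v) ω = x) hx.aemeasurable
      (hval (measurableSet_singleton x))]
    refine .of_forall fun ω => funext fun v => ?_
    simp [values, bridgePart_vertex]

end IsTreeBrownianFromZero

end MetricTree

theorem brownian_bridges {V : Type*} [Finite V] (T : MetricTree V) {n : ℕ} (S : Set V) (r : V)
    (σ : ℝ) (m : Measure (EuclideanSpace ℝ (Fin n))) (Q : Measure (T.PathSpace n))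
    (hm : SigmaFinite m) (hQ : T.IsBrownianReference r σ m Q) :
    (m = volume → S.Nonempty → SigmaFinite (T.jointLaw (fun i : S => (i : V)) Q)) ∧
      (∃ K, T.IsBridgeKernel (fun v : V => v) Q K) ∧
      (∀ K, T.IsBridgeKernel (fun v : V => v) Q K →
        ∀ᵐ x ∂(T.jointLaw (fun v : V => v) Q), T.IsEdgewiseBrownianBridge σ x (K x)) := by
  obtain ⟨W, hW, rfl⟩ := hQ
  have := hW.isProbabilityMeasure
  have hK := hW.isBridgeKernel (m := m)
  refine ⟨?_, ⟨_, hK⟩, fun K hK' => ?_⟩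
  · rintro rfl ⟨v, hv⟩
    refine MetricTree.sigmaFinite_jointLaw_of_map (⟨v, hv⟩ : S) ?_
    rw [hW.map_vertex_volume]
    infer_instance
  · have hσ : SigmaFinite (T.jointLaw (fun v : V => v)
        ((m.prod W).map fun p => ContinuousMap.const T.Space p.1 + p.2)) := by
      -- The root is among the vertices and has marginal `m`, so no assumption on the law at `S` is
      -- needed.
      refine MetricTree.sigmaFinite_jointLaw_of_map r ?_
      rwa [hW.map_vertex_root]
    have := hσ
    rw [MetricTree.jointLaw] at this
    filter_upwards [IsFiberKernel.ae_eq hK' hK (T.measurable_values _)] with x hx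
    rw [hx, MetricTree.IsTreeBrownianFromZero.bridgeKernel_apply]
    exact hW.isEdgewiseBrownianBridge_map x

theorem mainTheorem5 {V : Type*} [Fintype V] (T : MetricTree V) {n : ℕ} (S : Set V)
    (μ : S → Measure (EuclideanSpace ℝ (Fin n))) [∀ i, IsProbabilityMeasure (μ i)] :
    (∀ Q : Measure (T.PathSpace n), SigmaFinite (T.jointLaw (fun i : S => (i : V)) Q) →
      -- each problem has at most one solution
      (∀ P P', T.SolvesDynamic S μ Q P → T.SolvesDynamic S μ Q P' → P = P') ∧
      (∀ R R', T.SolvesStatic S μ Q R → T.SolvesStatic S μ Q R' → R = R') ∧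
      (∀ R R', T.SolvesStaticOn S μ Q R → T.SolvesStaticOn S μ Q R' → R = R') ∧
      -- dynamic problem and static problem over all vertices
      (∀ P, T.SolvesDynamic S μ Q P → T.SolvesStatic S μ Q (T.jointLaw (fun v : V => v) P)) ∧
      (∃ K, T.IsBridgeKernel (fun v : V => v) Q K) ∧
      (∀ R K, T.SolvesStatic S μ Q R → T.IsBridgeKernel (fun v : V => v) Q K →
        T.SolvesDynamic S μ Q (R.bind K)) ∧
      -- dynamic problem and static problem over the observed vertices
      (∀ P, T.SolvesDynamic S μ Q P →
        T.SolvesStaticOn S μ Q (T.jointLaw (fun i : S => (i : V)) P)) ∧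
      (∃ K, T.IsBridgeKernel (fun i : S => (i : V)) Q K) ∧
      (∀ R K, T.SolvesStaticOn S μ Q R → T.IsBridgeKernel (fun i : S => (i : V)) Q K →
        T.SolvesDynamic S μ Q (R.bind K))) ∧
    -- Brownian reference measure: all of this applies to the stationary one, and the bridges
    -- given the values at all vertices are independent Brownian bridges along the edges
    (∀ (r : V) (σ : ℝ) (m : Measure (EuclideanSpace ℝ (Fin n))) (Q : Measure (T.PathSpace n)),
      0 < σ → SigmaFinite m → T.IsBrownianReference r σ m Q →
      (m = volume → S.Nonempty → SigmaFinite (T.jointLaw (fun i : S => (i : V)) Q)) ∧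
      (∃ K, T.IsBridgeKernel (fun v : V => v) Q K) ∧
      (∀ K, T.IsBridgeKernel (fun v : V => v) Q K →
        ∀ᵐ x ∂(T.jointLaw (fun v : V => v) Q), T.IsEdgewiseBrownianBridge σ x (K x))) := by
  exact ⟨fun Q hQ => schroedinger_reduction T S μ Q hQ,
    fun r σ m Q _ hm hQ => brownian_bridges T S r σ m Q hm hQ⟩
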